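/- Let $S$ be a finite set of places of $\mathbb{Q}$ containing $\infty$ (put $\mathbb{Q}_\infty=\mathbb{R}$), let $n\ge 0$ and $d_\nu\ge 1$ $(\nu\in S)$ be integers, $d=\max_{\nu\in S} d_\nu$, and let $\mathbf U=\prod_{\nu\in S}U_\nu$, where each $U_\nu\subset\mathbb{Q}_\nu^{d_\nu}$ is an open box (a product of open balls of $\mathbb{Q}_\nu$). Vectors in $\mathbb{Q}_\nu^{d_\nu}$ are measured in the Euclidean norm if $\nu=\infty$ and in the supremum norm if $\nu$ is finite; $\prod_{\nu\in S}\mathbb{Q}_\nu^{d_\nu}$ carries the maximum metric and the product of Lebesgue measure (at $\infty$) and the Haar measures on $\mathbb{Q}_p$ giving $\mathbb{Z}_p$ measure $1$; this product measure is denoted $\mu$. On $\mathbb{Q}_S=\prod_{\nu\in S}\mathbb{Q}_\nu$ let $|y|_S=\max_{\nu\in S}|y_\nu|_\nu$. For every $\nu\in S$ let $f_\nu=(f_\nu^{(1)},\dots,f_\nu^{(n)}):U_\nu\to\mathbb{Q}_\nu^n$ and $\Theta_\nu:U_\nu\to\mathbb{Q}_\nu$ be such that * each $g\in\{f_\nu^{(1)},\dots,f_\nu^{(n)},\Theta_\nu\}$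 is analytic on $U_\nu$, extends analytically to the boundary of $U_\nu$, and satisfies $|g|_\nu\le 1$ and $\|\nabla g\|\le 1$ on $U_\nu$, and $|\Phi_\beta g|_\nu\le\frac12$ for all second-order difference quotients $\Phi_\beta g$ ($|\beta|=2$), at all points of $U_\nu$ where they are defined. Here $\Phi_{2e_i}g$ is the second divided difference of $g$ in the $i$-th variable at three distinct values, and $\Phi_{e_i+e_j}g$ $(i\ne j)$ is the first divided difference in the $i$-th variable of the first divided difference in the $j$-th variable; * the restrictions of $1,f_\nu^{(1)},\dots,f_\nu^{(n)}$ to any nonempty open subset of $U_\nu$ are linearly independent over $\mathbb{Q}_\nu$. Write $\mathbf f(\mathbf x)=(f_\nu(x_\nu))_\nu$ and $\Theta(\mathbf x)=(\Theta_\nu(x_\nu))_\nu$. For $C,\alpha>0$, a Borel measurable function $g$ on $V$ is called $(C,\alpha)$-good on $V$ if for every open ball $B\subset V$ centred in the support of $\mu$ and every $\varepsilon>0$ $$\mu(\{x\in B: |g(x)|<\varepsilon\})\le C\left(\frac{\varepsilon}{\sup_{x\in B}|g(x)|}\right)^{\alpha}\mu(B),$$ where the right-hand side is $\infty$ if $g$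 vanishes identically on $B$. Then for every $\mathbf x_0\in\mathbf U$ there are an open neighbourhood $\mathbf V\subset\mathbf U$ of $\mathbf x_0$, a constant $C>0$ and positive integers $k,k_1$ such that for all $(a_0,\mathbf a)\in\mathbb{Z}\times\mathbb{Z}^{n}$: 1. $\mathbf x\mapsto |a_0+\mathbf a\cdot\mathbf f(\mathbf x)+\Theta(\mathbf x)|_S$ is $\left(C,\frac1{dk}\right)$-good on $\mathbf V$; 2. for every $\nu\in S$, $\mathbf x\mapsto\|\nabla(\mathbf a\cdot f_\nu+\Theta_\nu)(x_\nu)\|$ is $\left(C,\frac1{dk_1}\right)$-good on $\mathbf V$. -/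

import Mathlib

open MeasureTheory
open scoped ENNReal

noncomputable section

/-! ### Analysis at one place: functions on `K^d` for a valued field `K` -/

section OnePlace

variable {K : Type*} [NontriviallyNormedField K] {d : ℕ}

/-- An open box in `K^d`: a product of open balls (intervals, if `K = ℝ`) of positive radius. -/
def IsOpenBox (U : Set (Fin d → K)) : Prop :=
  ∃ (c : Fin d → K) (r : Fin d → ℝ), (∀ i, 0 < r i) ∧
    U = Set.pi Set.univ (fun i => Metric.ball (c i) (r i))

/-- `g` is analytic on `U` and extends analytically to the boundary of `U`. Analytic means:
given by a convergent power series near every point. -/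
def AnalyticUpToBoundary (U : Set (Fin d → K)) (g : (Fin d → K) → K) : Prop :=
  AnalyticOnNhd K g U ∧
    ∃ h : (Fin d → K) → K, AnalyticOnNhd K h (closure U) ∧ Set.EqOn h g U

/-- The gradient `∇ g (x)`, the vector of the partial derivatives. -/
def grad (g : (Fin d → K) → K) (x : Fin d → K) : Fin d → K :=
  fun i => fderiv K g x (Pi.single i 1)

/-- The `L^q` norm of the gradient. It is used with `q = 2` at the infinite place (Euclidean norm)
and with `q = ∞` at the finite places (supremum norm). -/
def gradNorm (q : ℝ≥0∞) (g : (Fin d → K) → K) (x : Fin d → K) : ℝ :=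
  ‖(WithLp.toLp q (grad g x) : PiLp q (fun _ : Fin d => K))‖

/-- First difference quotient of a function of one variable. -/
def diffQuot₁ (g : K → K) (s t : K) : K := (g s - g t) / (s - t)

/-- Second difference quotient of a function of one variable. -/
def diffQuot₂ (g : K → K) (r s t : K) : K := (diffQuot₁ g r t - diffQuot₁ g s t) / (r - s)

/-- Every second difference quotient `Φ_β g`, `|β| = 2`, is bounded by `b` on `U` (a box): for
`β = 2 e_i` it is the second quotient in the `i`-th variable, for `β = e_i + e_j` with `i ≠ j` the
first quotient in the `i`-th variable of the first quotient in the `j`-th one. -/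
def SecondDiffQuotLE (U : Set (Fin d → K)) (g : (Fin d → K) → K) (b : ℝ) : Prop :=
  (∀ (i : Fin d) (x : Fin d → K) (r s t : K), r ≠ s → r ≠ t → s ≠ t →
      Function.update x i r ∈ U → Function.update x i s ∈ U → Function.update x i t ∈ U →
      ‖diffQuot₂ (fun u => g (Function.update x i u)) r s t‖ ≤ b) ∧
  (∀ (i j : Fin d), i ≠ j → ∀ (x : Fin d → K) (s s' t t' : K), s ≠ s' → t ≠ t' →
      Function.update (Function.update x i s) j t ∈ U →
      Function.update (Function.update x i s) j t' ∈ U →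
      Function.update (Function.update x i s') j t ∈ U →
      Function.update (Function.update x i s') j t' ∈ U →
      ‖diffQuot₁ (fun u => diffQuot₁
        (fun v => g (Function.update (Function.update x i u) j v)) t t') s s'‖ ≤ b)

/-- The normalization imposed on every component of `f_ν` and on `Θ_ν`. -/
structure NormalizedAnalytic (q : ℝ≥0∞) (U : Set (Fin d → K)) (g : (Fin d → K) → K) : Prop where
  analytic : AnalyticUpToBoundary U g
  norm_le : ∀ x ∈ U, ‖g x‖ ≤ 1
  gradNorm_le : ∀ x ∈ U, gradNorm q g x ≤ 1
  secondDiffQuot_le : SecondDiffQuotLE U g (1 / 2)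

/-- The restrictions of `1, f₁, …, f_n` to any nonempty open subset of `U` are linearly independent
over `K`. -/
def LocallyLinIndep {n : ℕ} (U : Set (Fin d → K)) (f : Fin n → (Fin d → K) → K) : Prop :=
  ∀ W : Set (Fin d → K), IsOpen W → W.Nonempty → W ⊆ U →
    LinearIndependent K
      (Fin.cons (fun _ => 1) (fun j (x : W) => f j x) : Fin (n + 1) → (W → K))

/-- The function `a · f + Θ` for an integer vector `a`. -/
def dotAdd {n : ℕ} (a : Fin n → ℤ) (f : Fin n → (Fin d → K) → K) (Θ : (Fin d → K) → K)
    (x : Fin d → K) : K :=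
  (∑ j, (a j : K) * f j x) + Θ x

end OnePlace

/-! ### `(C, α)`-good functions -/

/-- `g` is `(C, α)`-good on `V` with respect to `μ`. The inequality is read in `[0, ∞]`, so that
it is void on a ball on which `g` vanishes identically, where `ε / 0 = ∞`. -/
def IsGood {X F : Type*} [MetricSpace X] [MeasurableSpace X] [NormedField F] [MeasurableSpace F]
    (μ : Measure X) (C α : ℝ) (V : Set X) (g : X → F) : Prop :=
  Measurable (V.domRestrict g) ∧
    ∀ x ∈ μ.support, ∀ r : ℝ, 0 < r → Metric.ball x r ⊆ V → ∀ ε : ℝ, 0 < ε →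
      μ {y ∈ Metric.ball x r | ‖g y‖ < ε} ≤
        ENNReal.ofReal C * (ENNReal.ofReal ε / ⨆ y ∈ Metric.ball x r, ‖g y‖ₑ) ^ α *
          μ (Metric.ball x r)

/-! ### The `S`-adic space -/

instance factPrimeOfPrimes (p : Nat.Primes) : Fact (p : ℕ).Prime := ⟨p.2⟩

instance padicMeasurableSpace (p : ℕ) [Fact p.Prime] : MeasurableSpace ℚ_[p] := borel _

instance padicBorelSpace (p : ℕ) [Fact p.Prime] : BorelSpace ℚ_[p] := ⟨rfl⟩

/-- Haar measure on `ℚ_p`, normalized to give the unit ball `ℤ_p` measure `1`. -/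
def padicHaar (p : ℕ) [Fact p.Prime] : Measure ℚ_[p] :=
  Measure.addHaarMeasure
    { carrier := Metric.closedBall 0 1
      isCompact' := isCompact_closedBall 0 1
      interior_nonempty' :=
        ⟨0, Metric.ball_subset_interior_closedBall (Metric.mem_ball_self one_pos)⟩ }

/-- `ℚ_S` for the set of places consisting of `∞` and of the primes in `S`. -/
abbrev QS (S : Finset Nat.Primes) : Type := ℝ × (∀ p : S, ℚ_[(p : Nat.Primes)])

/-- The `S`-adic absolute value, the maximum of `|y_ν|_ν` over all places `ν`, `∞` included. -/
def sAbs {S : Finset Nat.Primes} (y : QS S) : ℝ := max |y.1| (⨆ p : S, ‖y.2 p‖)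

/-- The space `∏ ℚ_ν^{d_ν}` over `∞` and the primes in `S`, where `d_∞ = d₀`. The metric is the
maximum of the Euclidean metric at `∞` and of the supremum metrics at the finite places. -/
abbrev SSpace (S : Finset Nat.Primes) (d₀ : ℕ) (d : S → ℕ) : Type :=
  EuclideanSpace ℝ (Fin d₀) × (∀ p : S, Fin (d p) → ℚ_[(p : Nat.Primes)])

/-- The product of Lebesgue measure and of the normalized Haar measures. -/
def sMeasure (S : Finset Nat.Primes) (d₀ : ℕ) (d : S → ℕ) : Measure (SSpace S d₀ d) :=
  (volume : Measure (EuclideanSpace ℝ (Fin d₀))).prod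
    (Measure.pi fun p : S => Measure.pi fun _ : Fin (d p) => padicHaar (p : Nat.Primes))

/-- The product domain `∏ U_ν`. -/
def sProd {S : Finset Nat.Primes} {d₀ : ℕ} {d : S → ℕ} (U₀ : Set (Fin d₀ → ℝ))
    (U : ∀ p : S, Set (Fin (d p) → ℚ_[(p : Nat.Primes)])) : Set (SSpace S d₀ d) :=
  {x | x.1.ofLp ∈ U₀ ∧ ∀ p, x.2 p ∈ U p}

/-- The `ℚ_S`-valued map `x ↦ (g_ν (x_ν))_ν`. -/
def sMap {S : Finset Nat.Primes} {d₀ : ℕ} {d : S → ℕ} (g₀ : (Fin d₀ → ℝ) → ℝ)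
    (g : ∀ p : S, (Fin (d p) → ℚ_[(p : Nat.Primes)]) → ℚ_[(p : Nat.Primes)])
    (x : SSpace S d₀ d) : QS S :=
  (g₀ x.1.ofLp, fun p => g p (x.2 p))

end

/-! ### Haar measure under translations and dilations. -/

section HaarScaling

variable {E : Type*} [NormedAddCommGroup E] [ProperSpace E]
  [MeasurableSpace E] (ν : Measure E) [ν.IsAddHaarMeasure]

/-! At each place the integer vector enters only through the coefficients of a linear combination of
finitely many fixed analytic functions (1, the `f j`, `Θ`, or their partial derivatives). It is
therefore enough to show that all linear combinations `g` of finitely many functions analytic at a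
point of `K^d` are good near that point, with constants independent of the coefficients.

Two facts carry this. Remez inequality (`exists_norm_mul_pow_le_of_isPolyOnLines_scaled`): a
polynomial of bounded degree that is at most `ε` on a proportion `δ` of a ball is `O(ε δ^(-N))` on
the whole ball. Its proof uses only Haar measure and division by `X - v`, hence serves `ℝ` and `ℚ_p`
alike. Uniform Taylor approximation (`exists_uniform_approx`): for one degree `k` and a size `A` of
`g`, the Taylor polynomial at any nearby centre has, on the ball of radius `ρ`, remainder `O(A
ρ^(k+1))` and supremum at least a constant times `A ρ^k`. The degree comes from a descending chain
of kernels in the finite-dimensional coefficient space.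

In `exists_good_of_analyticAt` these are combined on a ball of radius `r`. If `A r^(k+1) ≤ ε`, the
remainder is harmless and Remez applies on the whole ball. Otherwise let `A ρ^(k+1) = ε`: on each
ball of radius about `ρ` the polynomial exceeds `ε` by a factor of order `1/ρ`, so `{|g| < ε}` fills
only a small proportion of it, and averaging over such balls gives the same for the large ball.

Goodness then passes to the `S`-adic space through the coordinate projections, and to `sAbs` and the
gradient norms because these are comparable to maxima of finitely many good functions. -/

theorem measureReal_closedBall_pos (x : E) {r : ℝ} (hr : 0 < r) :
    0 < ν.real (Metric.closedBall x r) :=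
  ENNReal.toReal_pos (Metric.measure_closedBall_pos ν x hr).ne' measure_closedBall_lt_top.ne

theorem measureReal_ball_pos (x : E) {r : ℝ} (hr : 0 < r) :
    0 < ν.real (Metric.ball x r) :=
  ENNReal.toReal_pos (Metric.measure_ball_pos ν x hr).ne' measure_ball_lt_top.ne

variable [BorelSpace E]

open scoped Pointwise in
/-- Dilations multiply Haar measure by a constant. -/
theorem exists_measureReal_smul {K : Type*} [NontriviallyNormedField K] [NormedSpace K E] (a : K) (ha : a ≠ 0) :
    ∃ χ : ℝ, 0 < χ ∧ ∀ s : Set E, ν.real (a • s) = χ * ν.real s := by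
  refine ⟨distribHaarChar E (Units.mk0 a ha), by exact_mod_cast distribHaarChar_pos, fun s => ?_⟩
  have h := distribHaarChar_mul ν (Units.mk0 a ha) s
  have h2 : (Units.mk0 a ha) • s = a • s := rfl
  rw [h2] at h
  rw [Measure.real, Measure.real, ← h, ENNReal.toReal_mul]
  simp

open scoped Pointwise in
theorem measureReal_closedBall_center (x : E) (r : ℝ) :
    ν.real (Metric.closedBall x r) = ν.real (Metric.closedBall 0 r) := by
  have : Metric.closedBall x r = x +ᵥ Metric.closedBall (0 : E) r := by simp
  rw [this, Measure.real, Measure.real, measure_vadd]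

open scoped Pointwise in
theorem measureReal_ball_center (x : E) (r : ℝ) :
    ν.real (Metric.ball x r) = ν.real (Metric.ball 0 r) := by
  have : Metric.ball x r = x +ᵥ Metric.ball (0 : E) r := by simp
  rw [this, Measure.real, Measure.real, measure_vadd]

open scoped Pointwise in
/-- Haar measure is doubling. -/
theorem exists_measureReal_closedBall_le (K : Type*) [NontriviallyNormedField K]
    [NormedSpace K E] (c : ℝ) :
    ∃ D : ℝ, 0 < D ∧ ∀ (x : E) (r : ℝ), 0 < r →
      ν.real (Metric.closedBall x (c * r)) ≤ D * ν.real (Metric.ball x r) := by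
  obtain ⟨b, hb⟩ := NormedField.exists_lt_norm K (max c 0)
  have hb0 : b ≠ 0 := norm_pos_iff.1 ((le_max_right _ _).trans_lt hb)
  obtain ⟨χ, hχ, h⟩ := exists_measureReal_smul ν b hb0
  refine ⟨χ, hχ, fun x r hr => ?_⟩
  rw [measureReal_closedBall_center, measureReal_ball_center, ← h, smul_ball hb0, smul_zero]
  refine measureReal_mono (Metric.closedBall_subset_ball ?_) measure_ball_lt_top.ne
  exact mul_lt_mul_of_pos_right ((le_max_left _ _).trans_lt hb) hr

end HaarScaling

/-! ### Radii of balls of small measure. -/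

section SmallBalls

variable {K : Type*} [NontriviallyNormedField K] [ProperSpace K]
  [MeasurableSpace K] [BorelSpace K] (μ : Measure K) [μ.IsAddHaarMeasure]

open scoped Pointwise in
-- Supplies the radius of a ball that can be removed from a set of measure `δ` while keeping half of
-- it. A radius polynomial in `δ` is what keeps the Remez inequality polynomial.
theorem exists_measureReal_ball_le :
    ∃ (c : ℝ) (N : ℕ), 0 < c ∧ ∀ δ : ℝ, 0 < δ → δ ≤ μ.real (Metric.closedBall 0 1) →
      ∀ v : K, μ.real (Metric.ball v (c * δ ^ N)) ≤ δ / 2 := by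
  obtain ⟨b, hb0, hb1⟩ := NormedField.exists_norm_lt_one K
  have hbne : b ≠ 0 := norm_pos_iff.1 hb0
  obtain ⟨χ, hχ, h⟩ := exists_measureReal_smul μ b hbne
  set ω := μ.real (Metric.closedBall (0 : K) 1) with hω
  have hωpos : 0 < ω := measureReal_closedBall_pos μ 0 one_pos
  have hpow : ∀ n : ℕ, μ.real (Metric.closedBall (0 : K) (‖b‖ ^ n)) = χ ^ n * ω := by
    intro n
    induction n with
    | zero => simp [hω]
    | succ n ih =>
      rw [pow_succ' χ, mul_assoc, ← ih, ← h, smul_closedBall' hbne, smul_zero, pow_succ']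
  have hlim : Filter.Tendsto (fun n : ℕ => χ ^ n * ω) Filter.atTop (nhds 0) := by
    have h1 : Filter.Tendsto (fun n : ℕ => μ (Metric.closedBall (0 : K) (‖b‖ ^ n)))
        Filter.atTop (nhds (μ (⋂ n : ℕ, Metric.closedBall (0 : K) (‖b‖ ^ n)))) := by
      refine tendsto_measure_iInter_atTop (fun n => measurableSet_closedBall.nullMeasurableSet) ?_
        ⟨0, measure_closedBall_lt_top.ne⟩
      intro i j hij
      exact Metric.closedBall_subset_closedBall (pow_le_pow_of_le_one hb0.le hb1.le hij)
    have h2 : (⋂ n : ℕ, Metric.closedBall (0 : K) (‖b‖ ^ n)) = {0} := by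
      ext t
      simp only [Set.mem_iInter, mem_closedBall_zero_iff, Set.mem_singleton_iff]
      constructor
      · intro ht
        have := ge_of_tendsto' (tendsto_pow_atTop_nhds_zero_of_lt_one hb0.le hb1) ht
        exact norm_le_zero_iff.1 this
      · rintro rfl n
        simp
    rw [h2, measure_singleton] at h1
    have h3 := (ENNReal.tendsto_toReal ENNReal.zero_ne_top).comp h1
    refine h3.congr fun n => ?_
    exact hpow n
  -- Otherwise the balls of radius `‖b‖ ^ n`, which shrink to a null set, would all have measure at
  -- least `ω`.
  have hχ1 : χ < 1 := by
    by_contra hge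
    have : ∀ n : ℕ, ω ≤ χ ^ n * ω := fun n =>
      le_mul_of_one_le_left hωpos.le (one_le_pow₀ (not_lt.1 hge))
    exact absurd (ge_of_tendsto' hlim this) (not_le.2 hωpos)
  -- `χ ^ N < ‖b‖` converts measures into radii. For the least `n` with `χ ^ n * ω ≤ δ / 2`, failure
  -- at `n - 1` gives `(δ / (2 * ω)) ^ N ≤ ‖b‖ ^ (n - 1)`; the extra factor `‖b‖` in the constant
  -- makes up for the shift by one.
  obtain ⟨N, hN⟩ := exists_pow_lt_of_lt_one hb0 hχ1
  refine ⟨‖b‖ * (2 * ω)⁻¹ ^ N, N, by positivity, fun δ hδ hδω v => ?_⟩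
  have hex : ∃ n : ℕ, χ ^ n * ω ≤ δ / 2 :=
    ((hlim.eventually (ge_mem_nhds (half_pos hδ))).exists)
  classical
  have hn := Nat.find_spec hex
  set n := Nat.find hex with hn_def
  have hn0 : n ≠ 0 := by
    intro h0
    rw [h0] at hn
    simp only [pow_zero, one_mul] at hn
    linarith
  obtain ⟨m, hm⟩ := Nat.exists_eq_succ_of_ne_zero hn0
  have hm' : δ / 2 < χ ^ m * ω := not_le.1 (Nat.find_min hex (by omega : m < Nat.find hex))
  have hle : ‖b‖ * (2 * ω)⁻¹ ^ N * δ ^ N ≤ ‖b‖ ^ n := by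
    rw [hm, Nat.succ_eq_add_one, pow_succ', mul_assoc, ← mul_pow]
    refine mul_le_mul_of_nonneg_left ?_ hb0.le
    calc ((2 * ω)⁻¹ * δ) ^ N ≤ (χ ^ m) ^ N := by
          refine pow_le_pow_left₀ (by positivity) ?_ N
          rw [inv_mul_le_iff₀ (by positivity)]
          linarith
      _ = (χ ^ N) ^ m := by rw [← pow_mul, ← pow_mul, mul_comm]
      _ ≤ ‖b‖ ^ m := pow_le_pow_left₀ (by positivity) hN.le m
  calc μ.real (Metric.ball v (‖b‖ * (2 * ω)⁻¹ ^ N * δ ^ N))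
      ≤ μ.real (Metric.closedBall v (‖b‖ ^ n)) :=
        measureReal_mono (Metric.ball_subset_closedBall.trans
          (Metric.closedBall_subset_closedBall hle)) measure_closedBall_lt_top.ne
    _ ≤ δ / 2 := by rw [measureReal_closedBall_center, hpow]; exact hn

end SmallBalls

/-! ### The Remez inequality in one variable. -/

section OneVariable

open Polynomial

variable {K : Type*} [NontriviallyNormedField K]

theorem norm_eval_le_of_degree_lt {m : ℕ} {Q : K[X]} (hQ : Q.degree < m) {b : ℝ}
    (hb : ∀ j, ‖Q.coeff j‖ ≤ b) {t : K} (ht : ‖t‖ ≤ 1) : ‖Q.eval t‖ ≤ m * b := by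
  rcases eq_or_ne Q 0 with rfl | h
  · have : 0 ≤ b := (norm_nonneg _).trans (hb 0)
    simpa using by positivity
  rw [eval_eq_sum, sum_over_range' Q (by simp) m ((natDegree_lt_iff_degree_lt h).2 hQ)]
  refine (norm_sum_le _ _).trans ?_
  have : ∀ j ∈ Finset.range m, ‖Q.coeff j * t ^ j‖ ≤ b := fun j _ => by
    rw [norm_mul, norm_pow]
    exact (mul_le_of_le_one_right (norm_nonneg _) (pow_le_one₀ (norm_nonneg _) ht)).trans (hb j)
  simpa using Finset.sum_le_card_nsmul _ _ _ this

variable [ProperSpace K] [MeasurableSpace K] [BorelSpace K] (μ : Measure K) [μ.IsAddHaarMeasure]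

/-- A Remez-type inequality: a polynomial of bounded degree that is small on a set of measure `δ`
in the unit ball has small coefficients. -/
theorem exists_norm_coeff_mul_pow_le (m : ℕ) :
    ∃ (C : ℝ) (N : ℕ), 0 < C ∧ ∀ (Q : K[X]), Q.degree < m → ∀ s ⊆ Metric.closedBall (0 : K) 1,
      ∀ δ : ℝ, 0 < δ → δ ≤ μ.real s → ∀ ε : ℝ, (∀ t ∈ s, ‖Q.eval t‖ ≤ ε) →
        ∀ j, ‖Q.coeff j‖ * δ ^ N ≤ C * ε := by
  have hne : ∀ s : Set K, ∀ δ : ℝ, 0 < δ → δ ≤ μ.real s → s.Nonempty := by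
    intro s δ hδ hs
    by_contra h
    rw [Set.not_nonempty_iff_eq_empty] at h
    rw [h] at hs
    simp at hs
    linarith
  induction m with
  | zero =>
    refine ⟨1, 0, one_pos, fun Q hQ s _ δ hδ hs ε hε j => ?_⟩
    obtain ⟨v, hv⟩ := hne s δ hδ hs
    have hQ0 : Q = 0 := by simpa using hQ
    have := hε v hv
    simp [hQ0] at this ⊢
    exact this
  | succ m ih =>
    obtain ⟨C, N, hC, ih⟩ := ih
    obtain ⟨c, N₀, hc, hball⟩ := exists_measureReal_ball_le μ
    set ω := μ.real (Metric.closedBall (0 : K) 1) with hω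
    have hωpos : 0 < ω := measureReal_closedBall_pos μ 0 one_pos
    refine ⟨ω ^ (N + N₀) + 2 * (C * 2 / c * 2 ^ N), N + N₀, by positivity,
      fun Q hQ s hs1 δ hδ hs ε hε j => ?_⟩
    obtain ⟨v, hv⟩ := hne s δ hδ hs
    have hv1 : ‖v‖ ≤ 1 := by simpa using hs1 hv
    have hfin : μ s ≠ ⊤ := measure_ne_top_of_subset hs1 measure_closedBall_lt_top.ne
    have hδω : δ ≤ ω := hs.trans (measureReal_mono hs1 measure_closedBall_lt_top.ne)
    have hε0 : 0 ≤ ε := (norm_nonneg _).trans (hε v hv)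
    -- Write `Q - Q(v) = (X - v) Q₁` with `v ∈ s`. Removing the ball of radius `r` about `v` costs
    -- at most `δ / 2` of measure, and outside it `Q₁` is at most `2 * ε / r`, so the induction
    -- hypothesis applies to `Q₁`.
    set r := c * δ ^ N₀ with hr
    have hrpos : 0 < r := by positivity
    set Q₁ := Q /ₘ (X - Polynomial.C v) with hQ₁
    have hQeq : Q = Polynomial.C (Q.eval v) + (X - Polynomial.C v) * Q₁ := by
      conv_lhs => rw [← modByMonic_add_div Q (X - Polynomial.C v)]
      rw [modByMonic_X_sub_C_eq_C_eval]
    have hdeg : Q₁.degree < m := by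
      rcases eq_or_ne Q 0 with h0 | h0
      · rw [hQ₁, h0, zero_divByMonic, degree_zero]
        exact WithBot.bot_lt_coe m
      · rcases lt_or_ge Q.degree 1 with h1 | h1
        · have : Q₁ = 0 := by
            rw [hQ₁, divByMonic_eq_zero_iff (monic_X_sub_C v), degree_X_sub_C]; exact h1
          rw [this, degree_zero]
          exact WithBot.bot_lt_coe m
        · have h2 := degree_add_divByMonic (monic_X_sub_C v) (p := Q) (by
            rw [degree_X_sub_C]; exact h1)
          rw [degree_X_sub_C, ← hQ₁] at h2
          rw [← h2] at hQ
          have h3 : Q₁ ≠ 0 := by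
            intro h3
            rw [h3, degree_zero] at h2
            simp at h2
            exact h0 (degree_eq_bot.1 h2.symm)
          rw [degree_eq_natDegree h3] at hQ ⊢
          norm_cast at hQ ⊢
          omega
    have hs' : δ / 2 ≤ μ.real (s \ Metric.ball v r) := by
      have h1 : μ.real s ≤ μ.real (s \ Metric.ball v r) + μ.real (Metric.ball v r) := by
        refine (measureReal_mono (s₂ := (s \ Metric.ball v r) ∪ Metric.ball v r) ?_ ?_).trans
          (measureReal_union_le _ _)
        · intro t ht; by_cases h : t ∈ Metric.ball v r <;> simp [ht, h]
        · refine (measure_union_lt_top ?_ measure_ball_lt_top).ne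
          exact (measure_mono Set.sdiff_subset).trans_lt hfin.lt_top
      have h2 := hball δ hδ hδω v
      linarith
    have hε' : ∀ t ∈ s \ Metric.ball v r, ‖Q₁.eval t‖ ≤ 2 * ε / r := by
      rintro t ⟨ht, htb⟩
      have h1 : Q.eval t - Q.eval v = (t - v) * Q₁.eval t := by
        conv_lhs => rw [hQeq]
        simp
      have h2 : r ≤ ‖t - v‖ := by simpa [dist_eq_norm] using htb
      rw [le_div_iff₀ hrpos]
      calc ‖Q₁.eval t‖ * r ≤ ‖Q₁.eval t‖ * ‖t - v‖ := by gcongr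
        _ = ‖Q.eval t - Q.eval v‖ := by rw [h1, norm_mul, mul_comm]
        _ ≤ ‖Q.eval t‖ + ‖Q.eval v‖ := norm_sub_le _ _
        _ ≤ 2 * ε := by linarith [hε t ht, hε v hv]
    have hcoeff : ∀ j, ‖Q₁.coeff j‖ * δ ^ (N + N₀) ≤ (C * 2 / c * 2 ^ N) * ε := by
      intro j
      have h := ih Q₁ hdeg _ (Set.sdiff_subset.trans hs1) (δ / 2) (by positivity) hs' _ hε' j
      rw [div_pow] at h
      calc ‖Q₁.coeff j‖ * δ ^ (N + N₀)
          = (‖Q₁.coeff j‖ * (δ ^ N / 2 ^ N)) * (2 ^ N * δ ^ N₀) := by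
            rw [pow_add]; field_simp
        _ ≤ (C * (2 * ε / r)) * (2 ^ N * δ ^ N₀) := by gcongr
        _ = (C * 2 / c * 2 ^ N) * ε := by rw [hr]; field_simp
    have h1 : ‖Q.coeff j‖ ≤ ε + ‖(X * Q₁).coeff j‖ + ‖Q₁.coeff j‖ := by
      conv_lhs => rw [hQeq]
      rw [sub_mul, coeff_add, coeff_sub, coeff_C_mul]
      have h2 : ‖(Polynomial.C (Q.eval v)).coeff j‖ ≤ ε := by
        rw [coeff_C]
        split_ifs
        · exact hε v hv
        · simpa using hε0
      have h3 : ‖v * Q₁.coeff j‖ ≤ ‖Q₁.coeff j‖ := by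
        rw [norm_mul]; exact mul_le_of_le_one_left (norm_nonneg _) hv1
      linarith [norm_add_le ((Polynomial.C (Q.eval v)).coeff j) ((X * Q₁).coeff j - v * Q₁.coeff j),
        norm_sub_le ((X * Q₁).coeff j) (v * Q₁.coeff j)]
    have h2 : ‖(X * Q₁).coeff j‖ * δ ^ (N + N₀) ≤ (C * 2 / c * 2 ^ N) * ε := by
      rcases j with _ | j
      · simp; positivity
      · rw [coeff_X_mul]; exact hcoeff j
    have h3 : ε * δ ^ (N + N₀) ≤ ε * ω ^ (N + N₀) := by gcongr
    calc ‖Q.coeff j‖ * δ ^ (N + N₀)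
        ≤ (ε + ‖(X * Q₁).coeff j‖ + ‖Q₁.coeff j‖) * δ ^ (N + N₀) := by gcongr
      _ ≤ (ω ^ (N + N₀) + 2 * (C * 2 / c * 2 ^ N)) * ε := by
        have := hcoeff j
        linarith

end OneVariable

/-! ### The Remez inequality in several variables. -/

section SeveralVariables

open Polynomial

variable {K : Type*} [NontriviallyNormedField K]

/-- On every affine line, `F` is a polynomial of degree less than `k` in the parameter. -/
def IsPolyOnLines {E : Type*} [AddCommGroup E] [Module K E] (k : ℕ) (F : E → K) : Prop :=
  ∀ a b : E, ∃ Q : K[X], Q.degree < k ∧ ∀ t : K, F (a + t • b) = Q.eval t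

variable [ProperSpace K] [MeasurableSpace K] [BorelSpace K] (μ : Measure K) [μ.IsAddHaarMeasure]

/-- Induction on the dimension by Fubini: many slices meet the small set in large measure, the
induction hypothesis bounds `F` on those slices, and the one-variable inequality in the transversal
direction bounds it everywhere. -/
theorem exists_norm_mul_pow_le_of_isPolyOnLines (k d : ℕ) :
    ∃ (C : ℝ) (N : ℕ), 0 < C ∧ ∀ F : (Fin d → K) → K, Continuous F → IsPolyOnLines k F →
      ∀ δ : ℝ, 0 < δ → ∀ ε : ℝ,
        δ ≤ (Measure.pi fun _ : Fin d => μ).real {u | ‖u‖ ≤ 1 ∧ ‖F u‖ ≤ ε} →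
        ∀ u, ‖u‖ ≤ 1 → ‖F u‖ * δ ^ N ≤ C * ε := by
  induction d with
  | zero =>
    refine ⟨1, 0, one_pos, fun F _ _ δ hδ ε hs u _ => ?_⟩
    have : {u | ‖u‖ ≤ 1 ∧ ‖F u‖ ≤ ε}.Nonempty := by
      by_contra h
      rw [Set.not_nonempty_iff_eq_empty] at h
      rw [h] at hs
      simp at hs
      linarith
    obtain ⟨v, _, hv⟩ := this
    rw [Subsingleton.elim u v]
    simpa using hv
  | succ d ih =>
    obtain ⟨C, N, hC, ih⟩ := ih
    obtain ⟨C₁, N₁, hC₁, h₁⟩ := exists_norm_coeff_mul_pow_le μ k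
    set ν : Measure (Fin d → K) := Measure.pi fun _ => μ with hν
    set ω := μ.real (Metric.closedBall (0 : K) 1) with hω
    have hωpos : 0 < ω := measureReal_closedBall_pos μ 0 one_pos
    set ω' := ν.real (Metric.closedBall 0 1) with hω'
    have hω'pos : 0 < ω' := measureReal_closedBall_pos ν 0 one_pos
    -- The `+ 1` keeps the constant positive when `k = 0`.
    refine ⟨(k * C₁ + 1) * (2 * ω') ^ N₁ * (C * (2 * ω) ^ N), N + N₁, by positivity,
      fun F hF hFp δ hδ ε hs u hu => ?_⟩
    set G : K × (Fin d → K) → K := fun p => F (Fin.cons p.1 p.2) with hG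
    have hGc : Continuous G := by
      refine hF.comp ?_
      exact Continuous.finCons (by fun_prop) (by fun_prop)
    set s : Set (K × (Fin d → K)) := {p | ‖p.1‖ ≤ 1 ∧ ‖p.2‖ ≤ 1 ∧ ‖G p‖ ≤ ε} with hs_def
    have hsm : MeasurableSet s := by
      refine IsClosed.measurableSet ?_
      have i₁ : IsClosed {p : K × (Fin d → K) | ‖p.1‖ ≤ 1} := isClosed_le (by fun_prop) (by fun_prop)
      have i₂ : IsClosed {p : K × (Fin d → K) | ‖p.2‖ ≤ 1} := isClosed_le (by fun_prop) (by fun_prop)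
      have i₃ : IsClosed {p : K × (Fin d → K) | ‖G p‖ ≤ ε} := isClosed_le (by fun_prop) (by fun_prop)
      exact i₁.inter (i₂.inter i₃)
    have hmp := measurePreserving_piFinSuccAbove (fun _ : Fin (d + 1) => μ) 0
    have hpre : {u | ‖u‖ ≤ 1 ∧ ‖F u‖ ≤ ε} =
        (MeasurableEquiv.piFinSuccAbove (fun _ : Fin (d + 1) => K) 0) ⁻¹' s := by
      ext w
      have hw : (Fin.cons (w 0) (Fin.tail w) : Fin (d + 1) → K) = w := Fin.cons_self_tail w
      have hn : ‖w‖ ≤ 1 ↔ ‖w 0‖ ≤ 1 ∧ ‖Fin.tail w‖ ≤ 1 := by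
        simp only [pi_norm_le_iff_of_nonneg zero_le_one, Fin.forall_fin_succ]
        rfl
      have hsp : (MeasurableEquiv.piFinSuccAbove (fun _ : Fin (d + 1) => K) 0) w =
          (w 0, Fin.tail w) := rfl
      rw [Set.mem_preimage, hsp, hs_def]
      simp only [Set.mem_ofPred_eq, hG, hw, hn, and_assoc]
    rw [hpre, Measure.real, hmp.measure_preimage hsm.nullMeasurableSet] at hs
    change δ ≤ ((μ.prod ν) s).toReal at hs
    -- The thin slices contribute at most `δ / 2` altogether, so the thick ones, each of measure at
    -- most `ω'`, give `μ T ≥ δ / (2 * ω')`. Measurability of `T` is not needed, as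
    -- `lintegral_indicator_const_le` holds for every set.
    set T : Set K := {t | ‖t‖ ≤ 1 ∧ ENNReal.ofReal (δ / (2 * ω)) ≤ ν (Prod.mk t ⁻¹' s)} with hT
    have hslice : ∀ t, Prod.mk t ⁻¹' s ⊆ Metric.closedBall 0 1 := by
      intro t w hw
      simpa using hw.2.1
    have hTsub : T ⊆ Metric.closedBall 0 1 := fun t ht => by simpa using ht.1
    have hTmeas : δ / (2 * ω') ≤ μ.real T := by
      have hle : (μ.prod ν) s ≤ ENNReal.ofReal (δ / (2 * ω)) * μ (Metric.closedBall 0 1) +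
          ν (Metric.closedBall 0 1) * μ T := by
        rw [Measure.prod_apply hsm]
        calc ∫⁻ t, ν (Prod.mk t ⁻¹' s) ∂μ
            ≤ ∫⁻ t, ((Metric.closedBall (0 : K) 1).indicator
                (fun _ => ENNReal.ofReal (δ / (2 * ω))) t +
                T.indicator (fun _ => ν (Metric.closedBall 0 1)) t) ∂μ := by
              refine lintegral_mono fun t => ?_
              by_cases ht : ‖t‖ ≤ 1
              · by_cases ht2 : t ∈ T
                · rw [Set.indicator_of_mem ht2]
                  exact (measure_mono (hslice t)).trans le_add_self
                · rw [Set.indicator_of_mem (by simpa using ht), Set.indicator_of_notMem ht2,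
                    add_zero]
                  simp only [hT, Set.mem_ofPred_eq, not_and, not_le] at ht2
                  exact (ht2 ht).le
              · have : Prod.mk t ⁻¹' s = ∅ := by
                  ext w
                  simp [hs_def, ht]
                rw [this]
                simp
          _ = ∫⁻ t, (Metric.closedBall (0 : K) 1).indicator
                (fun _ => ENNReal.ofReal (δ / (2 * ω))) t ∂μ +
                ∫⁻ t, T.indicator (fun _ => ν (Metric.closedBall 0 1)) t ∂μ :=
              lintegral_add_left (measurable_const.indicator measurableSet_closedBall) _
          _ ≤ _ := add_le_add (lintegral_indicator_const_le _ _) (lintegral_indicator_const_le _ _)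
      have hTfin : μ T ≠ ⊤ := measure_ne_top_of_subset hTsub measure_closedBall_lt_top.ne
      have h2 := ENNReal.toReal_mono (by
        refine ENNReal.add_ne_top.2 ⟨ENNReal.mul_ne_top ENNReal.ofReal_ne_top
          measure_closedBall_lt_top.ne, ENNReal.mul_ne_top measure_closedBall_lt_top.ne hTfin⟩) hle
      rw [ENNReal.toReal_add (ENNReal.mul_ne_top ENNReal.ofReal_ne_top
          measure_closedBall_lt_top.ne) (ENNReal.mul_ne_top measure_closedBall_lt_top.ne hTfin),
        ENNReal.toReal_mul, ENNReal.toReal_mul, ENNReal.toReal_ofReal (by positivity)] at h2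
      change _ ≤ δ / (2 * ω) * ω + ω' * μ.real T at h2
      have h3 : δ / (2 * ω) * ω = δ / 2 := by field_simp
      rw [div_le_iff₀ (by positivity)]
      linarith
    have hT' : ∀ t ∈ T, ∀ w : Fin d → K, ‖w‖ ≤ 1 →
        ‖G (t, w)‖ ≤ C * ε / (δ / (2 * ω)) ^ N := by
      intro t ht w hw
      rw [le_div_iff₀ (by positivity)]
      refine ih (fun w => G (t, w)) (by fun_prop) ?_ _ (by positivity) ε ?_ w hw
      · intro a b
        obtain ⟨Q, hQ, h⟩ := hFp (Fin.cons t a) (Fin.cons 0 b)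
        refine ⟨Q, hQ, fun z => ?_⟩
        rw [← h]
        simp only [hG]
        congr 1
        ext i
        refine Fin.cases ?_ (fun i => ?_) i <;> simp
      · have h1 := ENNReal.toReal_mono
          (measure_ne_top_of_subset (hslice t) measure_closedBall_lt_top.ne) ht.2
        rw [ENNReal.toReal_ofReal (by positivity)] at h1
        refine h1.trans (le_of_eq ?_)
        change ν.real _ = _
        congr 1
        ext w
        simp [hs_def, ht.1]
    -- On the line through `u` parallel to the first axis, `F` is a polynomial that is small for
    -- parameters in `T`.
    have hu' : u = Fin.cons 0 (Fin.tail u) + u 0 • Fin.cons 1 0 := by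
      ext i
      refine Fin.cases ?_ (fun i => ?_) i <;> simp [Fin.tail]
    obtain ⟨Q, hQ, h⟩ := hFp (Fin.cons 0 (Fin.tail u)) (Fin.cons 1 0)
    have htail : ‖Fin.tail u‖ ≤ 1 :=
      (pi_norm_le_iff_of_nonneg zero_le_one).2 fun i => (norm_le_pi_norm u i.succ).trans hu
    have hu0 : ‖u 0‖ ≤ 1 := (norm_le_pi_norm u 0).trans hu
    have hQT : ∀ t ∈ T, ‖Q.eval t‖ ≤ C * ε / (δ / (2 * ω)) ^ N := by
      intro t ht
      rw [← h]
      convert hT' t ht _ htail using 2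
      simp only [hG]
      congr 1
      ext i
      refine Fin.cases ?_ (fun i => ?_) i <;> simp
    have hco := h₁ Q hQ T hTsub _ (by positivity) hTmeas _ hQT
    have hev : ‖F u‖ ≤ k * (C₁ * (C * ε / (δ / (2 * ω)) ^ N) / (δ / (2 * ω')) ^ N₁) := by
      rw [hu', h]
      refine norm_eval_le_of_degree_lt hQ (fun j => ?_) hu0
      rw [le_div_iff₀ (by positivity)]
      exact hco j
    have hε0 : 0 ≤ ε := by
      by_contra hneg
      have : T.Nonempty := by
        by_contra h
        rw [Set.not_nonempty_iff_eq_empty] at h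
        rw [h] at hTmeas
        simp at hTmeas
        have : 0 < δ / (2 * ω') := by positivity
        linarith
      obtain ⟨t, ht⟩ := this
      have h1 := (norm_nonneg _).trans (hQT t ht)
      have h2 : C * ε / (δ / (2 * ω)) ^ N < 0 :=
        div_neg_of_neg_of_pos (mul_neg_of_pos_of_neg hC (not_le.1 hneg)) (by positivity)
      linarith
    calc ‖F u‖ * δ ^ (N + N₁)
        ≤ (k * (C₁ * (C * ε / (δ / (2 * ω)) ^ N) / (δ / (2 * ω')) ^ N₁)) * δ ^ (N + N₁) := by
          gcongr
      _ = (k * C₁) * (2 * ω') ^ N₁ * (C * (2 * ω) ^ N) * ε := by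
        rw [div_pow, div_pow, pow_add]
        field_simp
      _ ≤ (k * C₁ + 1) * (2 * ω') ^ N₁ * (C * (2 * ω) ^ N) * ε := by
        gcongr
        linarith

open scoped Pointwise in
-- Dilation by `a` multiplies all measures by the same `χ`, which cancels once measures are taken
-- relative to the ball.
theorem exists_norm_mul_pow_le_of_isPolyOnLines_scaled (k d : ℕ) :
    ∃ (C : ℝ) (N : ℕ), 0 < C ∧ ∀ F : (Fin d → K) → K, Continuous F → IsPolyOnLines k F →
      ∀ a : K, a ≠ 0 → ∀ δ : ℝ, 0 < δ → ∀ ε : ℝ,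
        δ * (Measure.pi fun _ : Fin d => μ).real (Metric.closedBall 0 ‖a‖) ≤
          (Measure.pi fun _ : Fin d => μ).real {u | ‖u‖ ≤ ‖a‖ ∧ ‖F u‖ ≤ ε} →
        ∀ u, ‖u‖ ≤ ‖a‖ → ‖F u‖ * δ ^ N ≤ C * ε := by
  obtain ⟨C, N, hC, h⟩ := exists_norm_mul_pow_le_of_isPolyOnLines μ k d
  set ν : Measure (Fin d → K) := Measure.pi fun _ => μ with hν
  set ω := ν.real (Metric.closedBall 0 1) with hω
  have hωpos : 0 < ω := measureReal_closedBall_pos ν 0 one_pos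
  refine ⟨C / ω ^ N, N, by positivity, fun F hF hFp a ha δ hδ ε hs u hu => ?_⟩
  obtain ⟨χ, hχ, hsm⟩ := exists_measureReal_smul ν a ha
  have ha' : 0 < ‖a‖ := norm_pos_iff.2 ha
  have h1 : ν.real (Metric.closedBall 0 ‖a‖) = χ * ω := by
    rw [hω, ← hsm, smul_closedBall' ha, smul_zero, mul_one]
  have h2 : {u | ‖u‖ ≤ ‖a‖ ∧ ‖F u‖ ≤ ε} = a • {u | ‖u‖ ≤ 1 ∧ ‖F (a • u)‖ ≤ ε} := by
    ext w
    rw [Set.mem_smul_set_iff_inv_smul_mem₀ ha]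
    simp only [Set.mem_ofPred_eq, smul_inv_smul₀ ha, norm_smul, norm_inv]
    rw [inv_mul_le_iff₀ ha', mul_one]
  rw [h1, h2, hsm, mul_left_comm] at hs
  have h3 := h (fun u => F (a • u)) (by fun_prop) (by
    intro b c
    obtain ⟨Q, hQ, hQe⟩ := hFp (a • b) (a • c)
    refine ⟨Q, hQ, fun t => ?_⟩
    rw [← hQe]
    simp only [smul_add, smul_comm a t c]) (δ * ω) (by positivity) ε (le_of_mul_le_mul_left hs hχ)
    (a⁻¹ • u) (by rw [norm_smul, norm_inv, inv_mul_le_iff₀ ha', mul_one]; exact hu)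
  rw [smul_inv_smul₀ ha, mul_pow] at h3
  rw [div_mul_eq_mul_div, le_div_iff₀ (by positivity), mul_assoc]
  exact h3

end SeveralVariables

/-! ### Passing from a small ball to the unit ball. -/

section SmallBallToUnitBall

open Polynomial

variable {K : Type*} [NontriviallyNormedField K] [ProperSpace K]

/-- A function that is polynomial on lines and bounded on a small ball is bounded on the unit ball
at the expected cost. -/
theorem exists_norm_mul_pow_le_of_closedBall {E : Type*} [NormedAddCommGroup E] [NormedSpace K E]
    (k : ℕ) :
    ∃ C : ℝ, 0 < C ∧ ∀ F : E → K, IsPolyOnLines (k + 1) F →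
      ∀ ρ : ℝ, 0 < ρ → ρ ≤ 1 → ∀ s : ℝ, (∀ u, ‖u‖ ≤ ρ → ‖F u‖ ≤ s) →
        ∀ u, ‖u‖ ≤ 1 → ‖F u‖ * ρ ^ k ≤ C * s := by
  borelize K
  obtain ⟨C, N, hC, h⟩ := exists_norm_coeff_mul_pow_le (Measure.addHaar (G := K)) (k + 1)
  set ω := (Measure.addHaar (G := K)).real (Metric.closedBall (0 : K) 1) with hω
  have hωpos : 0 < ω := measureReal_closedBall_pos _ 0 one_pos
  obtain ⟨b, hb⟩ := NormedField.exists_one_lt_norm K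
  have hb0 : 0 < ‖b‖ := one_pos.trans hb
  refine ⟨(k + 1) * (‖b‖ ^ k * (C / ω ^ N)), by positivity, fun F hF ρ hρ hρ1 s hs u hu => ?_⟩
  obtain ⟨Q, hQ, hQe⟩ := hF 0 u
  obtain ⟨a, ha0, ha1, ha2, -⟩ := rescale_to_shell hb hρ (one_ne_zero (α := K))
  simp only [smul_eq_mul, mul_one] at ha1 ha2
  have hs0 : 0 ≤ s := (norm_nonneg _).trans (hs 0 (by simpa using hρ.le))
  have hapos : 0 < ‖a‖ := norm_pos_iff.2 ha0
  have hco : ∀ j, ‖Q.coeff j‖ ≤ ‖b‖ ^ k * (C / ω ^ N) * s / ρ ^ k := by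
    intro j
    rcases lt_or_ge k j with hj | hj
    · rw [coeff_eq_zero_of_degree_lt (hQ.trans_le (by exact_mod_cast hj)), norm_zero]
      positivity
    -- With the whole unit ball as small set, the Remez inequality bounds the coefficients of
    -- `Q(aX)`. Since `‖a‖ ≥ ρ / ‖b‖` and `j ≤ k`, dividing by `a ^ j` costs at most `(‖b‖ / ρ) ^
    -- k`.
    have h1 := h (Q.comp (Polynomial.C a * X)) (by
        rw [show (Polynomial.C a * X : K[X]) = Polynomial.C a * X + Polynomial.C 0 by simp]
        rcases eq_or_ne Q 0 with rfl | hQ0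
        · simp
        refine lt_of_le_of_lt degree_le_natDegree ?_
        rw [natDegree_comp, natDegree_linear ha0, mul_one, ← degree_eq_natDegree hQ0]
        exact hQ) _ le_rfl ω hωpos le_rfl s (by
      intro t ht
      rw [mem_closedBall_zero_iff] at ht
      have := hQe (a * t)
      rw [zero_add] at this
      simp only [eval_comp, eval_mul, eval_C, eval_X]
      rw [← this]
      refine hs _ ?_
      rw [norm_smul, norm_mul]
      calc ‖a‖ * ‖t‖ * ‖u‖ ≤ ‖a‖ * 1 * 1 := by gcongr
        _ ≤ ρ := by simpa using ha1.le) j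
    rw [comp_C_mul_X_coeff, norm_mul, norm_pow] at h1
    rw [le_div_iff₀ (by positivity)]
    have h2 : ρ ^ k ≤ ‖b‖ ^ k * ‖a‖ ^ j := by
      calc ρ ^ k ≤ (‖b‖ * ‖a‖) ^ k := by
            refine pow_le_pow_left₀ hρ.le ?_ k
            rw [div_le_iff₀ hb0] at ha2
            linarith
        _ = ‖b‖ ^ k * ‖a‖ ^ k := mul_pow _ _ _
        _ ≤ ‖b‖ ^ k * ‖a‖ ^ j := by
          gcongr ?_ * ?_
          exact pow_le_pow_of_le_one hapos.le (ha1.le.trans hρ1) hj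
    calc ‖Q.coeff j‖ * ρ ^ k ≤ ‖Q.coeff j‖ * (‖b‖ ^ k * ‖a‖ ^ j) := by gcongr
      _ = ‖b‖ ^ k * (‖Q.coeff j‖ * ‖a‖ ^ j * ω ^ N / ω ^ N) := by field_simp
      _ ≤ ‖b‖ ^ k * (C * s / ω ^ N) := by gcongr
      _ = _ := by ring
  have hF1 : F u = Q.eval 1 := by rw [← hQe]; simp
  have := norm_eval_le_of_degree_lt hQ hco (t := 1) (by simp)
  rw [hF1]
  calc ‖Q.eval 1‖ * ρ ^ k ≤ (((k + 1 : ℕ) : ℝ) * (‖b‖ ^ k * (C / ω ^ N) * s / ρ ^ k)) * ρ ^ k := by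
        gcongr
    _ = _ := by push_cast; field_simp

end SmallBallToUnitBall

/-! ### Taylor polynomials with a remainder uniform in the centre. -/

section Taylor

open Polynomial

variable {K : Type*} [NontriviallyNormedField K]

namespace IsPolyOnLines

variable {E : Type*} [AddCommGroup E] [Module K E] {k : ℕ}

theorem sum {ι : Type*} (s : Finset ι) {F : ι → E → K} (h : ∀ i ∈ s, IsPolyOnLines k (F i)) :
    IsPolyOnLines k (fun u => ∑ i ∈ s, F i u) := by
  classical
  intro a b
  choose! Q hQ hQe using fun i (hi : i ∈ s) => h i hi a b
  refine ⟨∑ i ∈ s, Q i, ?_, fun t => ?_⟩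
  · refine (degree_sum_le _ _).trans_lt ?_
    exact (Finset.sup_lt_iff (WithBot.bot_lt_coe k)).2 hQ
  · rw [eval_finsetSum]
    exact Finset.sum_congr rfl fun i hi => hQe i hi t

theorem const_mul {F : E → K} (h : IsPolyOnLines k F) (c : K) :
    IsPolyOnLines k (fun u => c * F u) := by
  intro a b
  obtain ⟨Q, hQ, hQe⟩ := h a b
  refine ⟨Polynomial.C c * Q, ?_, fun t => by simp [hQe]⟩
  rw [← smul_eq_C_mul]
  exact (degree_smul_le _ _).trans_lt hQ

/-- Expand `q (a + t b, …, a + t b)` over the sets of slots that receive `t b`; such a set has at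
most `m` elements. -/
theorem of_multilinearMap {m : ℕ} (q : MultilinearMap K (fun _ : Fin m => E) K) (hm : m < k) :
    IsPolyOnLines k (fun u => q fun _ => u) := by
  intro a b
  refine ⟨∑ s : Finset (Fin m), Polynomial.C (q (s.piecewise (fun _ => b) (fun _ => a))) * X ^ s.card,
    ?_, fun t => ?_⟩
  · refine (degree_sum_le _ _).trans_lt ?_
    refine (Finset.sup_lt_iff (WithBot.bot_lt_coe k)).2 fun s _ => ?_
    refine (degree_C_mul_X_pow_le _ _).trans_lt ?_
    have : s.card ≤ m := by simpa using Finset.card_le_univ s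
    exact (Nat.cast_lt (α := WithBot ℕ)).2 (this.trans_lt hm)
  · have h1 : (fun _ : Fin m => a + t • b) = (fun _ => t • b) + fun _ => a := by
      ext; simp [add_comm]
    change q (fun _ => a + t • b) = _
    rw [h1, MultilinearMap.map_add_univ, eval_finsetSum]
    refine Finset.sum_congr rfl fun s _ => ?_
    have h2 : s.piecewise (fun _ => t • b) (fun _ => a) =
        s.piecewise (fun i => t • (s.piecewise (fun _ => b) (fun _ => a) : Fin m → E) i)
          (s.piecewise (fun _ => b) (fun _ => a)) := by
      ext i
      by_cases hi : i ∈ s <;> simp [hi]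
    rw [h2, MultilinearMap.map_piecewise_smul q (fun _ => t)]
    rw [Finset.prod_const, eval_mul, eval_C, eval_pow, eval_X, smul_eq_mul, mul_comm]

end IsPolyOnLines

/-- Taylor approximation, uniformly in the centre and with geometric control of the remainder. -/
theorem AnalyticAt.exists_isPolyOnLines_approx [CompleteSpace K] {E : Type*}
    [NormedAddCommGroup E] [NormedSpace K E] {h : E → K} {x₀ : E} (hh : AnalyticAt K h x₀) :
    ∃ R₀ : ℝ, 0 < R₀ ∧ ∀ R : ℝ, 0 < R → R ≤ R₀ → ∃ C : ℝ, 0 < C ∧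
      ∀ x, ‖x - x₀‖ ≤ R → ∀ k : ℕ, ∃ F : E → K, Continuous F ∧
      IsPolyOnLines k F ∧ ∀ u, ‖u‖ ≤ R → ‖h (x + u) - F u‖ ≤ C * (‖u‖ / (2 * R)) ^ k := by
  obtain ⟨p, r, hp⟩ := hh
  obtain ⟨ρ, hρ0, hρ⟩ := ENNReal.lt_iff_exists_nnreal_btwn.1 hp.r_pos
  have hρ0' : 0 < ρ := by exact_mod_cast hρ0
  refine ⟨ρ / 3, by positivity, fun R hR hRρ => ?_⟩
  lift R to NNReal using hR.le
  -- Room for centres at distance `R` and a Taylor series of radius `2 * R` about each, so that for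
  -- `‖u‖ ≤ R` the terms decay like `2 ^ (-m)`.
  have hR' : (R : ℝ≥0∞) + ((2 * R : NNReal) : ℝ≥0∞) < r := by
    refine lt_of_le_of_lt ?_ hρ
    norm_cast
    rw [← NNReal.coe_le_coe]
    push_cast
    linarith
  have hsum := p.changeOriginSeries_summable_aux₁ (hR'.trans_le hp.r_le)
  -- This one sum dominates the Taylor coefficients of all orders at all centres within `R` of `x₀`.
  set M := ∑' s : Σ k l : ℕ, { s : Finset (Fin (k + l)) // s.card = l },
      ‖p (s.1 + s.2.1)‖₊ * R ^ s.2.1 * (2 * R) ^ s.1 with hM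
  refine ⟨2 * (M + 1), by positivity, fun x hx k => ?_⟩
  set y := x - x₀ with hy
  have hyR : ‖y‖₊ ≤ R := by exact_mod_cast hx
  have hyr : (‖y‖₊ : ℝ≥0∞) < r :=
    lt_of_le_of_lt (by exact_mod_cast hyR) (lt_of_le_of_lt le_self_add hR')
  have hb : ∀ m, ‖p.changeOrigin y m‖₊ * (2 * R) ^ m ≤ M := by
    intro m
    have h1 := p.nnnorm_changeOrigin_le m (hyr.trans_le hp.r_le)
    have hs2 := (NNReal.summable_sigma.1 hsum).1 m
    have hs1 := p.changeOriginSeries_summable_aux₂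
      ((lt_of_le_of_lt le_self_add hR').trans_le hp.r_le) m
    calc ‖p.changeOrigin y m‖₊ * (2 * R) ^ m
        ≤ (∑' s : Σ l : ℕ, { s : Finset (Fin (m + l)) // s.card = l },
          ‖p (m + s.1)‖₊ * ‖y‖₊ ^ s.1) * (2 * R) ^ m := by gcongr
      _ ≤ (∑' s : Σ l : ℕ, { s : Finset (Fin (m + l)) // s.card = l },
          ‖p (m + s.1)‖₊ * R ^ s.1) * (2 * R) ^ m := by
        refine mul_le_mul_left ?_ _
        refine Summable.tsum_le_tsum (fun s => ?_) ?_ hs1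
        · gcongr
        · exact NNReal.summable_of_le (fun s => by gcongr) hs1
      _ = ∑' s : Σ l : ℕ, { s : Finset (Fin (m + l)) // s.card = l },
          ‖p (m + s.1)‖₊ * R ^ s.1 * (2 * R) ^ m := by rw [NNReal.tsum_mul_right]
      _ ≤ M := NNReal.tsum_comp_le_tsum_of_inj hsum (i := Sigma.mk m) sigma_mk_injective
  have hps := hp.changeOrigin hyr
  have hxy : x₀ + y = x := by simp [hy]
  rw [hxy] at hps
  refine ⟨(p.changeOrigin y).partialSum k, (p.changeOrigin y).partialSum_continuous k, ?_, ?_⟩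
  · refine IsPolyOnLines.sum (Finset.range k) (F := fun m u => p.changeOrigin y m fun _ => u) ?_
    intro m hm
    exact IsPolyOnLines.of_multilinearMap (p.changeOrigin y m).toMultilinearMap
      (Finset.mem_range.1 hm)
  · intro u hu
    have hu' : ‖u‖₊ ≤ R := by exact_mod_cast hu
    have hmem : u ∈ Metric.eball (0 : E) (r - ‖y‖₊) := by
      rw [mem_eball_zero_iff, lt_tsub_iff_right]
      refine lt_of_le_of_lt ?_ hR'
      rw [add_comm]
      rw [enorm_eq_nnnorm]
      refine add_le_add (by exact_mod_cast hyR) ?_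
      norm_cast
      refine hu'.trans ?_
      rw [two_mul]; exact le_self_add
    have hs := hps.hasSum hmem
    have hlt : ‖u‖ / (2 * R) ≤ 1 / 2 := by
      rw [div_le_div_iff₀ (by positivity) two_pos]
      linarith
    have hbound : ∀ m, ‖p.changeOrigin y m fun _ => u‖ ≤ (M + 1) * (‖u‖ / (2 * R)) ^ m := by
      intro m
      have h1 : ‖p.changeOrigin y m‖ * (2 * R) ^ m ≤ M := by exact_mod_cast hb m
      have h2 := (p.changeOrigin y m).le_opNorm (fun _ => u)
      simp only [Finset.prod_const, Finset.card_univ, Fintype.card_fin] at h2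
      refine h2.trans ?_
      rw [div_pow, ← mul_div_assoc, le_div_iff₀ (by positivity)]
      calc ‖p.changeOrigin y m‖ * ‖u‖ ^ m * (2 * R) ^ m
          = (‖p.changeOrigin y m‖ * (2 * R) ^ m) * ‖u‖ ^ m := by ring
        _ ≤ (M + 1) * ‖u‖ ^ m := by gcongr; linarith
    have h3 := norm_sub_le_of_geometric_bound_of_hasSum (by linarith) hbound hs k
    rw [norm_sub_rev]
    refine h3.trans ?_
    rw [div_le_iff₀ (by linarith)]
    have h4 : 0 ≤ (M + 1) * (‖u‖ / (2 * R)) ^ k := by positivity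
    nlinarith

end Taylor

/-! ### Taylor approximation of all linear combinations with one degree. -/

section Family

variable {K : Type*} [NontriviallyNormedField K] [ProperSpace K]
  {E : Type*} [NormedAddCommGroup E] [NormedSpace K E]
  {ι : Type*} [Fintype ι] {h : ι → E → K} {x₀ : E}

/-- Taylor approximation of linear combinations of finitely many analytic functions. -/
theorem exists_linearMap_approx (hh : ∀ j, AnalyticAt K (h j) x₀) :
    ∃ (R C : ℝ) (F : ℕ → E → (ι → K) →ₗ[K] (E → K)), 0 < R ∧ R ≤ 1 ∧ 0 < C ∧
      ∀ k x, ‖x - x₀‖ ≤ R → ∀ c, Continuous (F k x c) ∧ IsPolyOnLines k (F k x c) ∧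
        ∀ u, ‖u‖ ≤ R → ‖∑ j, c j * h j (x + u) - F k x c u‖ ≤ C * ‖c‖ * (‖u‖ / (2 * R)) ^ k := by
  choose R₀ hR₀ hR using fun j => (hh j).exists_isPolyOnLines_approx
  have hev : ∀ᶠ R in nhdsWithin (0 : ℝ) (Set.Ioi 0), 0 < R ∧ R ≤ 1 ∧ ∀ j, R ≤ R₀ j := by
    refine (eventually_mem_nhdsWithin).and (Filter.Eventually.and ?_ ?_)
    · exact nhdsWithin_le_nhds (eventually_le_nhds one_pos)
    · exact Filter.eventually_all.2 fun j => nhdsWithin_le_nhds (eventually_le_nhds (hR₀ j))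
  obtain ⟨R, hRpos, hR1, hRj⟩ := hev.exists
  choose C hC hF using fun j => hR j R hRpos (hRj j)
  choose! F hFc hFp hFb using hF
  refine ⟨R, ∑ j, C j + 1, fun k x =>
    ∑ j, (LinearMap.proj j : (ι → K) →ₗ[K] K).smulRight (F j x k), hRpos, hR1, ?_, ?_⟩
  · have : 0 ≤ ∑ j, C j := Finset.sum_nonneg fun j _ => (hC j).le
    linarith
  intro k x hx c
  have happ : (∑ j, (LinearMap.proj j : (ι → K) →ₗ[K] K).smulRight (F j x k)) c =
      fun u => ∑ j, c j * F j x k u := by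
    ext u
    simp [LinearMap.sum_apply]
  rw [happ]
  refine ⟨?_, ?_, fun u hu => ?_⟩
  · exact continuous_finsetSum _ fun j _ => continuous_const.mul (hFc j x hx k)
  · exact IsPolyOnLines.sum _ fun j _ => (hFp j x hx k).const_mul (c j)
  · rw [← Finset.sum_sub_distrib]
    have hnn : 0 ≤ (‖u‖ / (2 * R)) ^ k := by positivity
    calc ‖∑ j, (c j * h j (x + u) - c j * F j x k u)‖
        ≤ ∑ j, ‖c‖ * (C j * (‖u‖ / (2 * R)) ^ k) := by
          refine norm_sum_le_of_le _ fun j _ => ?_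
          rw [← mul_sub, norm_mul]
          exact mul_le_mul (norm_le_pi_norm c j) (hFb j x hx k u hu) (norm_nonneg _) (norm_nonneg _)
      _ = (∑ j, C j) * ‖c‖ * (‖u‖ / (2 * R)) ^ k := by
          rw [Finset.sum_mul, Finset.sum_mul]
          exact Finset.sum_congr rfl fun j _ => by ring
      _ ≤ (∑ j, C j + 1) * ‖c‖ * (‖u‖ / (2 * R)) ^ k := by
          gcongr
          linarith

/-- All linear combinations of finitely many analytic functions can be approximated near `x₀` by
Taylor polynomials of one and the same degree, with an error of higher order than the size of the
polynomial. -/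
theorem exists_uniform_approx [ProperSpace E] (hh : ∀ j, AnalyticAt K (h j) x₀) :
    ∃ (k : ℕ) (R C : ℝ), 0 < R ∧ 0 < C ∧ ∀ c : ι → K, ∃ A : ℝ, 0 ≤ A ∧
      ∀ x, ‖x - x₀‖ ≤ R → ∃ F : E → K, Continuous F ∧ IsPolyOnLines (k + 1) F ∧
        (∀ u, ‖u‖ ≤ R → ‖∑ j, c j * h j (x + u) - F u‖ ≤ C * A * ‖u‖ ^ (k + 1)) ∧
        (∀ u, ‖u‖ ≤ R → ‖∑ j, c j * h j (x + u)‖ ≤ C * A) ∧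
        ∀ ρ, 0 < ρ → ρ ≤ 1 → ∀ s, (∀ u, ‖u‖ ≤ ρ → ‖F u‖ ≤ s) → A * ρ ^ k ≤ C * s := by
  obtain ⟨R, C, F, hR, hR1, hC, hF⟩ := exists_linearMap_approx hh
  have h0 : ‖x₀ - x₀‖ ≤ R := by simpa using hR.le
  have hcs : CompactSpace (Metric.closedBall (0 : E) 1) :=
    isCompact_iff_compactSpace.1 (isCompact_closedBall _ _)
  -- Coefficients are sent to the approximating polynomial at `x₀`, seen as a function on the unit
  -- ball; linearity makes kernels available.
  let T : ℕ → (ι → K) →ₗ[K] C(Metric.closedBall (0 : E) 1, K) := fun k =>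
    { toFun := fun c => ⟨fun u => F k x₀ c u, (hF k x₀ h0 c).1.comp continuous_subtype_val⟩
      map_add' := fun c c' => by ext u; simp
      map_smul' := fun a c => by ext u; simp }
  have hT : ∀ k c u, T k c u = F k x₀ c u := fun _ _ _ => rfl
  -- If the degree-`l` polynomial vanishes, the function is `O(ρ ^ (l + 1))` for `‖u‖ ≤ ρ`, so the
  -- degree-`k` one is `O(ρ ^ (k + 1))` there. Passing to the unit ball costs `ρ ^ (-k)`, leaving
  -- `O(ρ)` for every small `ρ`.
  have hker : ∀ k l : ℕ, k ≤ l → (T (l + 1)).ker ≤ (T (k + 1)).ker := by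
    intro k l hkl c hc
    obtain ⟨C₄, hC₄, h₄⟩ := exists_norm_mul_pow_le_of_closedBall (K := K) (E := E) k
    rw [LinearMap.mem_ker] at hc ⊢
    ext u
    rw [hT, ContinuousMap.zero_apply, ← norm_le_zero_iff]
    have hu1 : ‖(u : E)‖ ≤ 1 := mem_closedBall_zero_iff.1 u.2
    have hsmall : ∀ ρ : ℝ, 0 < ρ → ρ ≤ R →
        ‖F (k + 1) x₀ c u‖ ≤ C₄ * (2 * (C * ‖c‖) / (2 * R) ^ (k + 1)) * ρ := by
      intro ρ hρ hρR
      have := h₄ _ (hF (k + 1) x₀ h0 c).2.1 ρ hρ (hρR.trans hR1)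
        (2 * (C * ‖c‖ * (ρ / (2 * R)) ^ (k + 1))) (by
          intro w hw
          have hw1 : w ∈ Metric.closedBall (0 : E) 1 := by
            simpa using hw.trans (hρR.trans hR1)
          have hl : F (l + 1) x₀ c w = 0 := by
            rw [← hT (l + 1) c ⟨w, hw1⟩, hc]; rfl
          have i1 := (hF (k + 1) x₀ h0 c).2.2 w (hw.trans hρR)
          have i2 := (hF (l + 1) x₀ h0 c).2.2 w (hw.trans hρR)
          rw [hl, sub_zero] at i2
          have hle : ‖w‖ / (2 * R) ≤ ρ / (2 * R) := by gcongr
          have hle1 : ‖w‖ / (2 * R) ≤ 1 := by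
            rw [div_le_one (by positivity)]
            linarith
          have j2 : (‖w‖ / (2 * R)) ^ (l + 1) ≤ (ρ / (2 * R)) ^ (k + 1) :=
            (pow_le_pow_of_le_one (by positivity) hle1 (by omega)).trans
              (pow_le_pow_left₀ (by positivity) hle _)
          have j1 : (‖w‖ / (2 * R)) ^ (k + 1) ≤ (ρ / (2 * R)) ^ (k + 1) :=
            pow_le_pow_left₀ (by positivity) hle _
          have k1 : C * ‖c‖ * (‖w‖ / (2 * R)) ^ (k + 1) ≤ C * ‖c‖ * (ρ / (2 * R)) ^ (k + 1) := by
            gcongr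
          have k2 : C * ‖c‖ * (‖w‖ / (2 * R)) ^ (l + 1) ≤ C * ‖c‖ * (ρ / (2 * R)) ^ (k + 1) :=
            mul_le_mul_of_nonneg_left j2 (by positivity)
          have := norm_sub_le (∑ j, c j * h j (x₀ + w))
            (∑ j, c j * h j (x₀ + w) - F (k + 1) x₀ c w)
          rw [sub_sub_cancel] at this
          linarith) u hu1
      have hρk : 0 < ρ ^ k := by positivity
      refine le_of_mul_le_mul_right (this.trans (le_of_eq ?_)) hρk
      rw [div_pow]
      ring
    have hlim : Filter.Tendsto (fun ρ : ℝ => C₄ * (2 * (C * ‖c‖) / (2 * R) ^ (k + 1)) * ρ)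
        (nhdsWithin 0 (Set.Ioi 0)) (nhds 0) := by
      have : Filter.Tendsto (fun ρ : ℝ => C₄ * (2 * (C * ‖c‖) / (2 * R) ^ (k + 1)) * ρ)
        (nhds 0) (nhds (C₄ * (2 * (C * ‖c‖) / (2 * R) ^ (k + 1)) * 0)) :=
          (continuous_const.mul continuous_id).tendsto _
      rw [mul_zero] at this
      exact this.mono_left nhdsWithin_le_nhds
    refine ge_of_tendsto hlim ?_
    filter_upwards [Ioc_mem_nhdsGT hR] with ρ hρ using hsmall ρ hρ.1 hρ.2
  -- The kernels descend in a finite-dimensional space, so they stabilize. Coefficients in the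
  -- stable kernel give a function with zero approximations of all high degrees, hence zero near
  -- `x₀`.
  obtain ⟨k, hk⟩ := IsArtinian.monotone_stabilizes (R := K) (M := ι → K)
    ⟨fun k => OrderDual.toDual (T (k + 1)).ker, fun k l hkl => hker k l hkl⟩
  have hkerk : ∀ c, T (k + 1) c = 0 → ∀ z, ‖z - x₀‖ ≤ R → ∑ j, c j * h j z = 0 := by
    intro c hc z hz
    have hb : ∀ l ≥ k, ‖∑ j, c j * h j z‖ ≤ C * ‖c‖ * (1 / 2) ^ (l + 1) := by
      intro l hl
      have hcl : c ∈ (T (l + 1)).ker := by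
        have h1 : (T (k + 1)).ker = (T (l + 1)).ker := congrArg OrderDual.ofDual (hk l hl)
        rw [← h1]; exact hc
      have hz1 : z - x₀ ∈ Metric.closedBall (0 : E) 1 := by
        simpa [dist_eq_norm] using hz.trans hR1
      have hl0 : F (l + 1) x₀ c (z - x₀) = 0 := by
        rw [← hT (l + 1) c ⟨z - x₀, hz1⟩, LinearMap.mem_ker.1 hcl]; rfl
      have := (hF (l + 1) x₀ h0 c).2.2 (z - x₀) hz
      rw [hl0, sub_zero, add_sub_cancel] at this
      refine this.trans ?_
      have hle : ‖z - x₀‖ / (2 * R) ≤ 1 / 2 := by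
        rw [div_le_div_iff₀ (by positivity) two_pos]
        linarith
      exact mul_le_mul_of_nonneg_left (pow_le_pow_left₀ (by positivity) hle _) (by positivity)
    have hlim : Filter.Tendsto (fun l : ℕ => C * ‖c‖ * (1 / 2 : ℝ) ^ (l + 1)) Filter.atTop
        (nhds (C * ‖c‖ * 0)) := by
      refine Filter.Tendsto.const_mul _ ?_
      exact (tendsto_pow_atTop_nhds_zero_of_lt_one (by norm_num) (by norm_num)).comp
        (Filter.tendsto_add_atTop_nat 1)
    rw [mul_zero] at hlim
    rw [← norm_le_zero_iff]
    refine ge_of_tendsto hlim ?_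
    filter_upwards [Filter.eventually_ge_atTop k] with l hl using hb l hl
  -- The section replaces `c` by coefficients `c'` of the same function near `x₀` whose norm is
  -- controlled by the polynomial. It is bounded because the range is finite-dimensional, and `‖c'‖`
  -- serves as the size `A`.
  obtain ⟨σ, hσ⟩ := (T (k + 1)).rangeRestrict.exists_rightInverse_of_surjective
    (LinearMap.range_rangeRestrict _)
  let σ' : (T (k + 1)).range →L[K] (ι → K) := σ.toContinuousLinearMap
  obtain ⟨C₄, hC₄, h₄⟩ := exists_norm_mul_pow_le_of_closedBall (K := K) (E := E) k
  set M : ℝ := ‖σ'‖ + 1 with hM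
  have hMpos : 0 < M := by positivity
  -- Chosen so that `κ * τ ≤ 1` makes the error of changing the centre, of order `‖c'‖ * τ ^ (k +
  -- 1)`, at most half of the main term `‖c'‖ * τ ^ k`.
  set κ : ℝ := 2 * (M * C₄ * (2 * C / R ^ (k + 1))) with hκ
  have hκpos : 0 < κ := by positivity
  set τ : ℝ := min (R / 2) (1 / κ) with hτ
  have hτpos : 0 < τ := by positivity
  have hτR : 2 * τ ≤ R := by have := min_le_left (R / 2) (1 / κ); linarith
  have hτκ : κ * τ ≤ 1 := by
    have := min_le_right (R / 2) (1 / κ)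
    rw [le_div_iff₀ hκpos] at this
    linarith
  set M₂ : ℝ := 2 * M * C₄ * C₄ / τ ^ k with hM₂
  have hM₂pos : 0 < M₂ := by positivity
  refine ⟨k, τ, C / (2 * R) ^ (k + 1) + C + M₂, hτpos, by positivity, fun c => ?_⟩
  set c' : ι → K := σ ((T (k + 1)).rangeRestrict c) with hc'
  have hTc' : T (k + 1) c' = T (k + 1) c := by
    have := LinearMap.congr_fun hσ ((T (k + 1)).rangeRestrict c)
    exact congrArg Subtype.val this
  have hgc : ∀ z, ‖z - x₀‖ ≤ R → ∑ j, c j * h j z = ∑ j, c' j * h j z := by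
    intro z hz
    have := hkerk (c - c') (by rw [map_sub, hTc', sub_self]) z hz
    simpa [sub_mul, Finset.sum_sub_distrib, sub_eq_zero] using this
  have hnorm : ∀ s : ℝ, (∀ u, ‖u‖ ≤ 1 → ‖F (k + 1) x₀ c' u‖ ≤ s) → ‖c'‖ ≤ M * s := by
    intro s hs
    have hs0 : 0 ≤ s := (norm_nonneg _).trans (hs 0 (by simp))
    have h1 : ‖c'‖ ≤ ‖σ'‖ * ‖(T (k + 1)).rangeRestrict c‖ := σ'.le_opNorm _
    have h2 : ‖(T (k + 1)).rangeRestrict c‖ ≤ s := by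
      change ‖T (k + 1) c‖ ≤ s
      rw [← hTc', ContinuousMap.norm_le _ hs0]
      intro u
      rw [hT]
      exact hs u (mem_closedBall_zero_iff.1 u.2)
    calc ‖c'‖ ≤ ‖σ'‖ * ‖(T (k + 1)).rangeRestrict c‖ := h1
      _ ≤ M * s := by gcongr; linarith
  refine ⟨‖c'‖, norm_nonneg _, fun x hx => ?_⟩
  have hxR : ‖x - x₀‖ ≤ R := by linarith
  have hmem : ∀ u, ‖u‖ ≤ τ → ‖x + u - x₀‖ ≤ R := by
    intro u hu
    rw [add_sub_right_comm]
    linarith [norm_add_le (x - x₀) u]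
  refine ⟨F (k + 1) x c', (hF (k + 1) x hxR c').1, (hF (k + 1) x hxR c').2.1, ?_, ?_, ?_⟩
  · intro u hu
    rw [hgc _ (hmem u hu)]
    refine ((hF (k + 1) x hxR c').2.2 u (by linarith)).trans ?_
    rw [div_pow]
    calc C * ‖c'‖ * (‖u‖ ^ (k + 1) / (2 * R) ^ (k + 1))
        = (C / (2 * R) ^ (k + 1)) * ‖c'‖ * ‖u‖ ^ (k + 1) := by ring
      _ ≤ _ := by gcongr; linarith
  · intro u hu
    rw [hgc _ (hmem u hu)]
    -- Degree less than `0` means the zero polynomial, so the remainder estimate of order `0` is a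
    -- bound for the function itself.
    have hz : F 0 x₀ c' (x + u - x₀) = 0 := by
      obtain ⟨Q, hQ, hQe⟩ := (hF 0 x₀ h0 c').2.1 (x + u - x₀) 0
      have hQ0 : Q = 0 := by simpa using hQ
      have := hQe 0
      simpa [hQ0] using this
    have := (hF 0 x₀ h0 c').2.2 (x + u - x₀) (hmem u hu)
    rw [hz, sub_zero, add_sub_cancel, pow_zero, mul_one] at this
    refine this.trans ?_
    gcongr
    have : 0 < C / (2 * R) ^ (k + 1) := by positivity
    linarith
  -- The polynomials centred at `x` and `x₀` both approximate the same function near `x₀`, so the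
  -- lower bound known at `x₀` passes to `x`, the discrepancy being absorbed by the choice of `τ`.
  · have hone : ∀ s, (∀ u, ‖u‖ ≤ 1 → ‖F (k + 1) x c' u‖ ≤ s) →
        ‖c'‖ * τ ^ k ≤ 2 * M * C₄ * s := by
      intro s hs
      have h1 := h₄ _ (hF (k + 1) x₀ h0 c').2.1 τ hτpos (by linarith)
        (s + 2 * (C * ‖c'‖ * (τ / R) ^ (k + 1))) (by
          intro v hv
          have hu : ‖x₀ + v - x‖ ≤ 2 * τ := by
            rw [show x₀ + v - x = v - (x - x₀) by abel]
            linarith [norm_sub_le v (x - x₀)]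
          have i1 := (hF (k + 1) x₀ h0 c').2.2 v (by linarith)
          have i2 := (hF (k + 1) x hxR c').2.2 (x₀ + v - x) (by linarith)
          rw [add_sub_cancel] at i2
          have i3 := hs (x₀ + v - x) (by linarith)
          have j1 : C * ‖c'‖ * (‖v‖ / (2 * R)) ^ (k + 1) ≤ C * ‖c'‖ * (τ / R) ^ (k + 1) := by
            gcongr
            linarith
          have j2 : C * ‖c'‖ * (‖x₀ + v - x‖ / (2 * R)) ^ (k + 1) ≤
              C * ‖c'‖ * (τ / R) ^ (k + 1) := by
            gcongr ?_ * ?_ ^ _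
            rw [div_le_div_iff₀ (by positivity) hR]
            nlinarith
          have t1 := norm_sub_le (∑ j, c' j * h j (x₀ + v))
            (∑ j, c' j * h j (x₀ + v) - F (k + 1) x₀ c' v)
          rw [sub_sub_cancel] at t1
          have t2 := norm_add_le (∑ j, c' j * h j (x₀ + v) - F (k + 1) x c' (x₀ + v - x))
            (F (k + 1) x c' (x₀ + v - x))
          rw [sub_add_cancel] at t2
          linarith)
      have hτk : 0 < τ ^ k := by positivity
      have h2 := hnorm (C₄ * (s + 2 * (C * ‖c'‖ * (τ / R) ^ (k + 1))) / τ ^ k) (by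
        intro u hu
        rw [le_div_iff₀ hτk]
        exact h1 u hu)
      rw [← mul_div_assoc, le_div_iff₀ hτk] at h2
      have h3 : M * (C₄ * (2 * (C * ‖c'‖ * (τ / R) ^ (k + 1)))) =
          (κ * τ) / 2 * (‖c'‖ * τ ^ k) := by
        rw [hκ, div_pow]
        ring
      have h4 : (κ * τ) / 2 * (‖c'‖ * τ ^ k) ≤ 1 / 2 * (‖c'‖ * τ ^ k) := by gcongr
      linarith
    intro ρ hρ hρ1 s hs
    have h1 := h₄ _ (hF (k + 1) x hxR c').2.1 ρ hρ hρ1 s hs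
    have hρk : 0 < ρ ^ k := by positivity
    have h2 := hone (C₄ * s / ρ ^ k) (fun u hu => by
      rw [le_div_iff₀ hρk]
      exact h1 u hu)
    have hτk : 0 < τ ^ k := by positivity
    have hs0 : 0 ≤ s := (norm_nonneg _).trans (hs 0 (by simpa using hρ.le))
    calc ‖c'‖ * ρ ^ k = ‖c'‖ * τ ^ k * (ρ ^ k / τ ^ k) := by field_simp
      _ ≤ 2 * M * C₄ * (C₄ * s / ρ ^ k) * (ρ ^ k / τ ^ k) := by gcongr
      _ = M₂ * s := by rw [hM₂]; field_simp
      _ ≤ _ := by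
        gcongr
        have : 0 < C / (2 * R) ^ (k + 1) := by positivity
        linarith

end Family

/-! ### Uniform goodness of analytic families at one place. -/

section OnePlaceGood

/-- Averaging over translates of a ball. -/
theorem lintegral_measure_inter_closedBall {E : Type*} [NormedAddCommGroup E] [ProperSpace E]
    [MeasurableSpace E] [BorelSpace E] (ν : Measure E) [ν.IsAddHaarMeasure] {s : Set E}
    (hs : MeasurableSet s) (ρ : ℝ) :
    ∫⁻ y, ν (s ∩ Metric.closedBall y ρ) ∂ν = ν s * ν (Metric.closedBall 0 ρ) := by
  set G : Set (E × E) := {p | p.2 ∈ s ∧ dist p.2 p.1 ≤ ρ} with hG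
  have hGm : MeasurableSet G :=
    (measurable_snd hs).inter
      (measurableSet_le (measurable_snd.dist measurable_fst) measurable_const)
  have h1 : (ν.prod ν) G = ∫⁻ y, ν (s ∩ Metric.closedBall y ρ) ∂ν := by
    rw [Measure.prod_apply hGm]
    rfl
  have h2 : (ν.prod ν) G = ∫⁻ z, s.indicator (fun _ => ν (Metric.closedBall 0 ρ)) z ∂ν := by
    rw [Measure.prod_apply_symm hGm]
    refine lintegral_congr fun z => ?_
    by_cases hz : z ∈ s
    · rw [Set.indicator_of_mem hz]
      have : (fun x => (x, z)) ⁻¹' G = Metric.closedBall z ρ := by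
        ext y
        simp [hG, hz, dist_comm]
      have h3 := measureReal_closedBall_center ν z ρ
      rw [this]
      exact (ENNReal.toReal_eq_toReal_iff' measure_closedBall_lt_top.ne
        measure_closedBall_lt_top.ne).1 h3
    · rw [Set.indicator_of_notMem hz]
      have : (fun x => (x, z)) ⁻¹' G = ∅ := by
        ext y
        simp [hG, hz]
      rw [this, measure_empty]
  rw [← h1, h2, lintegral_indicator_const hs, mul_comm]

variable {K : Type*} [NontriviallyNormedField K] [ProperSpace K] [MeasurableSpace K] [BorelSpace K]
  (μ : Measure K) [μ.IsAddHaarMeasure]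

/-- On a small ball around an arbitrary centre, a function close to a polynomial satisfies a
Remez-type inequality. -/
theorem exists_approx_remez (k d : ℕ) :
    ∃ (C : ℝ) (N : ℕ), 0 < C ∧ ∀ (g F : (Fin d → K) → K) (x : Fin d → K), Continuous F →
      IsPolyOnLines k F → ∀ a : K, a ≠ 0 → ∀ ε η : ℝ,
      (∀ u, ‖u‖ ≤ ‖a‖ → ‖g (x + u) - F u‖ ≤ η) → ∀ s ⊆ Metric.closedBall x ‖a‖,
      (∀ z ∈ s, ‖g z‖ ≤ ε) → ∀ δ : ℝ, 0 < δ →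
      δ * (Measure.pi fun _ : Fin d => μ).real (Metric.closedBall 0 ‖a‖) ≤
        (Measure.pi fun _ : Fin d => μ).real s →
      ∀ u, ‖u‖ ≤ ‖a‖ → ‖F u‖ * δ ^ N ≤ C * (ε + η) := by
  obtain ⟨C, N, hC, h⟩ := exists_norm_mul_pow_le_of_isPolyOnLines_scaled μ k d
  refine ⟨C, N, hC, fun g F x hF hFp a ha ε η hη s hs hsε δ hδ hδs => ?_⟩
  refine h F hF hFp a ha δ hδ (ε + η) (hδs.trans ?_)
  have h1 : (Measure.pi fun _ : Fin d => μ).real ((fun u => x + u) ⁻¹' s) =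
      (Measure.pi fun _ : Fin d => μ).real s := by
    rw [Measure.real, Measure.real, measure_preimage_add]
  rw [← h1]
  refine measureReal_mono ?_ ?_
  · intro u hu
    have hu1 : ‖u‖ ≤ ‖a‖ := by simpa using hs hu
    refine ⟨hu1, ?_⟩
    have t1 := hsε _ hu
    have t2 := hη u hu1
    have t3 := norm_sub_le (g (x + u)) (g (x + u) - F u)
    rw [sub_sub_cancel] at t3
    linarith
  · refine ne_top_of_le_ne_top (measure_closedBall_lt_top (x := 0) (r := ‖a‖)).ne (measure_mono ?_)
    exact fun u hu => mem_closedBall_zero_iff.2 hu.1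

set_option maxHeartbeats 1000000 in
/-- Linear combinations of finitely many analytic functions are uniformly good near a point. -/
theorem exists_good_of_analyticAt {d : ℕ} {ι : Type*} [Fintype ι] {h : ι → (Fin d → K) → K}
    {x₀ : Fin d → K} (hh : ∀ j, AnalyticAt K (h j) x₀) :
    ∃ (L : ℕ) (R C : ℝ), 1 ≤ L ∧ 0 < R ∧ 0 < C ∧ ∀ c : ι → K, ∀ x, ‖x - x₀‖ ≤ R →
      ∀ r, 0 < r → r ≤ R → ∀ ε, 0 < ε → ∀ y ∈ Metric.ball x r,
        (Measure.pi fun _ : Fin d => μ).real {z ∈ Metric.ball x r | ‖∑ j, c j * h j z‖ < ε} ^ L *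
          ‖∑ j, c j * h j y‖ ≤
        C * ε * (Measure.pi fun _ : Fin d => μ).real (Metric.ball x r) ^ L := by
  set ν : Measure (Fin d → K) := Measure.pi fun _ => μ with hν
  obtain ⟨k, R, C, hR, hC, happ⟩ := exists_uniform_approx hh
  obtain ⟨C₃, N, hC₃, hremez⟩ := exists_approx_remez μ (k + 1) d
  obtain ⟨b, hb⟩ := NormedField.exists_one_lt_norm K
  have hb0 : 0 < ‖b‖ := one_pos.trans hb
  obtain ⟨D, hD, hdoub⟩ := exists_measureReal_closedBall_le ν K (2 * ‖b‖)
  have hcont : ∀ᶠ R₁ in nhdsWithin (0 : ℝ) (Set.Ioi 0),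
      ∀ j, ∀ z ∈ Metric.ball x₀ R₁, ContinuousAt (h j) z := by
    refine Filter.eventually_all.2 fun j => ?_
    obtain ⟨ε, hε, hball⟩ := Metric.eventually_nhds_iff_ball.1 (hh j).eventually_analyticAt
    filter_upwards [Ioc_mem_nhdsGT hε] with R₁ hR₁ z hz
    exact (hball z (Metric.ball_subset_ball hR₁.2 hz)).continuousAt
  obtain ⟨R₁, hcR₁, hR₁⟩ := (hcont.and (eventually_mem_nhdsWithin)).exists
  have hR₁pos : 0 < R₁ := hR₁
  -- Centres up to `3 * R'` from `x₀` and displacements up to `‖b‖ * R'` occur below; the bound `R₁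
  -- / 2` keeps the balls in the region of continuity.
  set R' : ℝ := min (min (R / (3 + ‖b‖)) (R₁ / 2)) 1 with hR'
  have hR'pos : 0 < R' := by positivity
  have hR'1 : R' ≤ 1 := min_le_right _ _
  have hR'R : (3 + ‖b‖) * R' ≤ R := by
    have : R' ≤ R / (3 + ‖b‖) := (min_le_left _ _).trans (min_le_left _ _)
    rw [le_div_iff₀ (by positivity)] at this
    linarith
  have hR'R₁ : 2 * R' ≤ R₁ := by
    have : R' ≤ R₁ / 2 := (min_le_left _ _).trans (min_le_right _ _)
    linarith
  set C₅ : ℝ := C * ‖b‖ ^ (k + 1) with hC₅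
  set C₆ : ℝ := C₃ * (1 + C₅) + C₅ with hC₆
  set C₇ : ℝ := ‖b‖ ^ k * (C * (C₃ * (1 + C))) with hC₇
  have hC₅pos : 0 < C₅ := by positivity
  have hC₆pos : 0 < C₆ := by positivity
  have hC₇pos : 0 < C₇ := by positivity
  -- The power `N + 1` turns the proportion bound `q` into a multiple of `ρ`, and `k + 1` turns `ρ`
  -- into `ε / A`. Using `N + 1` allows the root to be taken even if `N = 0`.
  set L : ℕ := (N + 1) * (k + 1) with hL
  refine ⟨L, R', D ^ N * C₆ + C * (D ^ (N + 1) * C₇) ^ (k + 1), by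
    rw [hL]; exact Nat.mul_pos (by omega) (by omega), hR'pos, by positivity,
    fun c x hx r hr hrR ε hε y hy => ?_⟩
  obtain ⟨A, hA, hF⟩ := happ c
  set g : (Fin d → K) → K := fun z => ∑ j, c j * h j z with hg
  change ν.real {z ∈ Metric.ball x r | ‖g z‖ < ε} ^ L * ‖g y‖ ≤ _
  set s : Set (Fin d → K) := {z ∈ Metric.ball x r | ‖g z‖ < ε} with hs
  set B := ν.real (Metric.ball x r) with hB
  have hBpos : 0 < B := measureReal_ball_pos ν x hr
  have hsB : s ⊆ Metric.ball x r := fun z hz => hz.1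
  have hfin : ∀ t ⊆ Metric.ball x r, ν t ≠ ⊤ := fun t ht =>
    measure_ne_top_of_subset ht measure_ball_lt_top.ne
  have hsle : ν.real s ≤ B := measureReal_mono hsB measure_ball_lt_top.ne
  set θ := ν.real s / B with hθ
  have hθ0 : 0 ≤ θ := by positivity
  have hθ1 : θ ≤ 1 := div_le_one_of_le₀ hsle hBpos.le
  suffices hmain : θ ^ L * ‖g y‖ ≤ (D ^ N * C₆ + C * (D ^ (N + 1) * C₇) ^ (k + 1)) * ε by
    have hsθ : ν.real s = θ * B := by rw [hθ]; field_simp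
    rw [hsθ, mul_pow]
    calc θ ^ L * B ^ L * ‖g y‖ = (θ ^ L * ‖g y‖) * B ^ L := by ring
      _ ≤ _ := by gcongr
  have hbR : ‖b‖ * R' + 3 * R' ≤ R := by linarith
  have hbR' : 0 < ‖b‖ * R' := by positivity
  have hxR : ‖x - x₀‖ ≤ R := by linarith
  have hyx : ‖y - x‖ < r := by rwa [mem_ball_iff_norm] at hy
  rcases eq_or_lt_of_le (measureReal_nonneg (μ := ν) (s := s)) with hs0 | hs0
  · have : θ = 0 := by rw [hθ, ← hs0, zero_div]
    rw [this, zero_pow (by rw [hL]; positivity), zero_mul]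
    positivity
  have hθpos : 0 < θ := by positivity
  have hgA : ‖g y‖ ≤ C * A := by
    obtain ⟨F, -, -, -, hbd, -⟩ := hF x hxR
    have := hbd (y - x) (by linarith)
    simpa [hg] using this
  -- In the first case the Taylor remainder on the whole ball is `O(ε)` and one application of Remez
  -- suffices.
  rcases le_or_gt (A * r ^ (k + 1)) ε with hcase | hcase
  · obtain ⟨a, ha0, ha1, ha2, -⟩ :=
      rescale_to_shell hb (mul_pos hb0 hr) (one_ne_zero (α := K))
    simp only [smul_eq_mul, mul_one] at ha1 ha2
    rw [mul_div_cancel_left₀ _ hb0.ne'] at ha2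
    have hbr : ‖b‖ * r ≤ ‖b‖ * R' := by gcongr
    obtain ⟨F, hFc, hFp, hFa, -, -⟩ := hF x hxR
    have hη : ∀ u, ‖u‖ ≤ ‖a‖ → ‖g (x + u) - F u‖ ≤ C₅ * ε := by
      intro u hu
      refine (hFa u (by linarith)).trans ?_
      calc C * A * ‖u‖ ^ (k + 1) ≤ C * A * (‖b‖ * r) ^ (k + 1) := by
            gcongr
            linarith
        _ = C₅ * (A * r ^ (k + 1)) := by rw [hC₅, mul_pow]; ring
        _ ≤ C₅ * ε := by gcongr
    set ω := ν.real (Metric.closedBall 0 ‖a‖) with hω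
    have hωpos : 0 < ω := measureReal_closedBall_pos ν 0 (norm_pos_iff.2 ha0)
    have hsa : s ⊆ Metric.closedBall x ‖a‖ :=
      hsB.trans (Metric.ball_subset_closedBall.trans (Metric.closedBall_subset_closedBall ha2))
    have hδ1 : ν.real s / ω ≤ 1 := by
      refine div_le_one_of_le₀ ?_ hωpos.le
      rw [hω, ← measureReal_closedBall_center ν x]
      exact measureReal_mono hsa measure_closedBall_lt_top.ne
    have hδpos : 0 < ν.real s / ω := by positivity
    have hrem := hremez g F x hFc hFp a ha0 ε (C₅ * ε) hη s hsa (fun z hz => hz.2.le)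
      (ν.real s / ω) hδpos (by rw [div_mul_cancel₀ _ hωpos.ne']) (y - x) (by linarith)
    have hgy : ‖g y‖ * (ν.real s / ω) ^ N ≤ C₆ * ε := by
      have t1 := hη (y - x) (by linarith)
      rw [add_sub_cancel] at t1
      have t2 : ‖g y‖ ≤ ‖F (y - x)‖ + C₅ * ε := by
        have := norm_add_le (g y - F (y - x)) (F (y - x))
        rw [sub_add_cancel] at this
        linarith
      calc ‖g y‖ * (ν.real s / ω) ^ N
          ≤ (‖F (y - x)‖ + C₅ * ε) * (ν.real s / ω) ^ N := by gcongr
        _ = ‖F (y - x)‖ * (ν.real s / ω) ^ N + C₅ * ε * (ν.real s / ω) ^ N := by ring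
        _ ≤ C₃ * (ε + C₅ * ε) + C₅ * ε * 1 := by
          gcongr
          exact pow_le_one₀ hδpos.le hδ1
        _ = C₆ * ε := by rw [hC₆]; ring
    have hωB : ω ≤ D * B := by
      have h1 := hdoub x r hr
      rw [measureReal_closedBall_center] at h1
      refine le_trans (measureReal_mono (Metric.closedBall_subset_closedBall ?_)
        measure_closedBall_lt_top.ne) h1
      linarith [mul_pos hb0 hr]
    have hθδ : θ ≤ D * (ν.real s / ω) := by
      rw [hθ, div_le_iff₀ hBpos]
      calc ν.real s = (ν.real s / ω) * ω := by field_simp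
        _ ≤ (ν.real s / ω) * (D * B) := by gcongr
        _ = _ := by ring
    have hNL : N ≤ L := by rw [hL]; nlinarith
    calc θ ^ L * ‖g y‖ ≤ θ ^ N * ‖g y‖ := by
          gcongr ?_ * _
          exact pow_le_pow_of_le_one hθ0 hθ1 hNL
      _ ≤ (D * (ν.real s / ω)) ^ N * ‖g y‖ := by gcongr
      _ = D ^ N * (‖g y‖ * (ν.real s / ω) ^ N) := by rw [mul_pow]; ring
      _ ≤ D ^ N * (C₆ * ε) := by gcongr
      _ = D ^ N * C₆ * ε := by ring
      _ ≤ _ := by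
        gcongr
        have : 0 < C * (D ^ (N + 1) * C₇) ^ (k + 1) := by positivity
        linarith
  · have hApos : 0 < A := by
      rcases eq_or_lt_of_le hA with h0 | h0
      · rw [← h0, zero_mul] at hcase
        linarith
      · exact h0
    -- The scale at which the Taylor remainder has the size of `ε`.
    obtain ⟨ρ, hρ, hρk⟩ : ∃ ρ : ℝ, 0 < ρ ∧ ρ ^ (k + 1) = ε / A :=
      ⟨(ε / A) ^ (((k + 1 : ℕ) : ℝ)⁻¹), by positivity,
        Real.rpow_inv_natCast_pow (by positivity) (by omega)⟩
    have hρε : A * ρ ^ (k + 1) = ε := by rw [hρk]; field_simp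
    have hρr : ρ < r := by
      rw [← hρε] at hcase
      exact lt_of_pow_lt_pow_left₀ (k + 1) hr.le (lt_of_mul_lt_mul_left hcase hA)
    obtain ⟨a, ha0, ha1, ha2, -⟩ := rescale_to_shell hb hρ (one_ne_zero (α := K))
    simp only [smul_eq_mul, mul_one] at ha1 ha2
    have hapos : 0 < ‖a‖ := norm_pos_iff.2 ha0
    set ω := ν.real (Metric.closedBall 0 ‖a‖) with hω
    have hωpos : 0 < ω := measureReal_closedBall_pos ν 0 hapos
    obtain ⟨q, hq, hqN⟩ : ∃ q : ℝ, 0 < q ∧ q ^ (N + 1) = C₇ * ρ :=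
      ⟨(C₇ * ρ) ^ (((N + 1 : ℕ) : ℝ)⁻¹), by positivity,
        Real.rpow_inv_natCast_pow (by positivity) (by omega)⟩
    -- Remez bounds the polynomial on this ball by `O(ε (t / ω) ^ (-N))`, while its supremum there
    -- is at least of order `A ρ ^ k = ε / ρ`. Hence `(t / ω) ^ N ≤ C₇ * ρ`.
    have hlocal : ∀ y', ‖y' - x₀‖ ≤ R →
        ν.real (s ∩ Metric.closedBall y' ‖a‖) ≤ q * ω := by
      intro y' hy'
      set t := ν.real (s ∩ Metric.closedBall y' ‖a‖) with ht
      rcases eq_or_lt_of_le (measureReal_nonneg (μ := ν) (s := s ∩ Metric.closedBall y' ‖a‖))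
        with h0 | h0
      · rw [ht, ← h0]; positivity
      have hδpos : 0 < t / ω := by positivity
      have hδ1 : t / ω ≤ 1 := by
        refine div_le_one_of_le₀ ?_ hωpos.le
        rw [hω, ← measureReal_closedBall_center ν y']
        exact measureReal_mono Set.inter_subset_right measure_closedBall_lt_top.ne
      obtain ⟨F, hFc, hFp, hFa, -, hFl⟩ := hF y' hy'
      have hη : ∀ u, ‖u‖ ≤ ‖a‖ → ‖g (y' + u) - F u‖ ≤ C * ε := by
        intro u hu
        refine (hFa u (by linarith)).trans ?_
        rw [mul_assoc, ← hρε]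
        gcongr
        linarith
      have hrem := hremez g F y' hFc hFp a ha0 ε (C * ε) hη _ Set.inter_subset_right
        (fun z (hz : z ∈ s ∩ _) => hz.1.2.le) (t / ω) hδpos (by rw [div_mul_cancel₀ _ hωpos.ne'])
      have hδN : 0 < (t / ω) ^ N := by positivity
      have hlow := hFl ‖a‖ hapos (by linarith) (C₃ * (ε + C * ε) / (t / ω) ^ N) (fun u hu => by
        rw [le_div_iff₀ hδN]
        exact hrem u hu)
      rw [← mul_div_assoc, le_div_iff₀ hδN] at hlow
      have hδρ : (t / ω) ^ N ≤ C₇ * ρ := by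
        have hAρ : 0 < A * ρ ^ k := by positivity
        refine le_of_mul_le_mul_left ?_ hAρ
        have h1 : ρ ^ k ≤ ‖b‖ ^ k * ‖a‖ ^ k := by
          rw [← mul_pow]
          refine pow_le_pow_left₀ hρ.le ?_ k
          rw [div_le_iff₀ hb0] at ha2
          linarith
        calc A * ρ ^ k * (t / ω) ^ N ≤ A * (‖b‖ ^ k * ‖a‖ ^ k) * (t / ω) ^ N := by gcongr
          _ = ‖b‖ ^ k * (A * ‖a‖ ^ k * (t / ω) ^ N) := by ring
          _ ≤ ‖b‖ ^ k * (C * (C₃ * (ε + C * ε))) := by gcongr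
          _ = A * ρ ^ k * (C₇ * ρ) := by rw [hC₇, ← hρε]; ring
      have hδq : t / ω ≤ q := by
        refine le_of_pow_le_pow_left₀ (n := N + 1) (by omega) hq.le ?_
        rw [hqN]
        exact (pow_le_pow_of_le_one hδpos.le hδ1 (Nat.le_succ N)).trans hδρ
      rwa [div_le_iff₀ hωpos] at hδq
    have hgc : ContinuousOn g (Metric.ball x r) := by
      intro z hz
      refine ContinuousAt.continuousWithinAt ?_
      refine tendsto_finsetSum _ fun j _ => ?_
      refine (hcR₁ j z ?_).const_mul (c j)
      rw [mem_ball_iff_norm] at hz ⊢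
      have := norm_add_le (z - x) (x - x₀)
      rw [sub_add_sub_cancel] at this
      linarith
    have hsm : MeasurableSet s := by
      have : s = Metric.ball x r ∩ (fun z => ‖g z‖) ⁻¹' Set.Iio ε := rfl
      rw [this]
      exact (hgc.norm.isOpen_inter_preimage Metric.isOpen_ball isOpen_Iio).measurableSet
    -- Averaging replaces a covering argument. Only centres within `2 * r` of `x` matter, and
    -- doubling compares that ball with the original one.
    have havg := lintegral_measure_inter_closedBall ν hsm ‖a‖
    have hle : ∫⁻ y, ν (s ∩ Metric.closedBall y ‖a‖) ∂ν ≤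
        ENNReal.ofReal (q * ω) * ν (Metric.closedBall x (2 * r)) := by
      refine le_trans (lintegral_mono fun y' => ?_) (lintegral_indicator_const_le _ _)
      by_cases hy' : y' ∈ Metric.closedBall x (2 * r)
      · rw [Set.indicator_of_mem hy']
        rw [mem_closedBall_iff_norm] at hy'
        have h1 := hlocal y' (by
          have := norm_add_le (y' - x) (x - x₀)
          rw [sub_add_sub_cancel] at this
          linarith)
        exact (ENNReal.le_ofReal_iff_toReal_le (hfin _ (Set.inter_subset_left.trans hsB))
          (by positivity)).2 h1
      · have : s ∩ Metric.closedBall y' ‖a‖ = ∅ := by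
          ext z
          simp only [Set.mem_inter_iff, Set.mem_empty_iff_false, iff_false, not_and]
          intro hz hz'
          refine hy' ?_
          have h1 := hsB hz
          rw [Metric.mem_ball] at h1
          rw [Metric.mem_closedBall] at hz' ⊢
          have := dist_triangle_left y' x z
          linarith
        rw [this, measure_empty]
        exact zero_le
    rw [havg] at hle
    have hle' := ENNReal.toReal_mono (ENNReal.mul_ne_top ENNReal.ofReal_ne_top
      measure_closedBall_lt_top.ne) hle
    rw [ENNReal.toReal_mul, ENNReal.toReal_mul, ENNReal.toReal_ofReal (by positivity)] at hle'
    change ν.real s * ω ≤ q * ω * ν.real (Metric.closedBall x (2 * r)) at hle'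
    have hdB : ν.real (Metric.closedBall x (2 * r)) ≤ D * B := by
      refine le_trans (measureReal_mono (Metric.closedBall_subset_closedBall ?_)
        measure_closedBall_lt_top.ne) (hdoub x r hr)
      nlinarith
    have hθq : θ ≤ D * q := by
      rw [hθ, div_le_iff₀ hBpos]
      refine le_of_mul_le_mul_right ?_ hωpos
      calc ν.real s * ω ≤ q * ω * ν.real (Metric.closedBall x (2 * r)) := hle'
        _ ≤ q * ω * (D * B) := by gcongr
        _ = D * q * B * ω := by ring
    have hθL : θ ^ L ≤ (D ^ (N + 1) * C₇) ^ (k + 1) * (ε / A) := by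
      calc θ ^ L ≤ (D * q) ^ L := by gcongr
        _ = (D ^ (N + 1) * q ^ (N + 1)) ^ (k + 1) := by rw [hL, pow_mul, mul_pow D q]
        _ = (D ^ (N + 1) * C₇) ^ (k + 1) * ρ ^ (k + 1) := by rw [hqN, ← mul_assoc, mul_pow]
        _ = _ := by rw [hρk]
    calc θ ^ L * ‖g y‖ ≤ ((D ^ (N + 1) * C₇) ^ (k + 1) * (ε / A)) * (C * A) := by gcongr
      _ = C * (D ^ (N + 1) * C₇) ^ (k + 1) * ε := by field_simp
      _ ≤ _ := by
        gcongr
        have : 0 < D ^ N * C₆ := by positivity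
        linarith

end OnePlaceGood

/-! ### Permanence properties of goodness in root-free form. -/

section PowGood

variable {X Y : Type*} [PseudoMetricSpace X] [MeasurableSpace X] [PseudoMetricSpace Y]
  [MeasurableSpace Y]

/-- The function `g ≥ 0` is good near `x₀` with exponent `1 / L`, written without division and
without roots. -/
def IsPowGood (μ : Measure X) (L : ℕ) (C R : ℝ) (x₀ : X) (g : X → ℝ) : Prop :=
  ∀ x, dist x x₀ ≤ R → ∀ r, 0 < r → r ≤ R → ∀ ε, 0 < ε → ∀ y ∈ Metric.ball x r,
    μ.real {z ∈ Metric.ball x r | g z < ε} ^ L * g y ≤ C * ε * μ.real (Metric.ball x r) ^ L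

namespace IsPowGood

variable {μ : Measure X} {ν : Measure Y} {L : ℕ} {C R : ℝ} {x₀ : X} {g : X → ℝ}

/-- Raising `L` weakens the inequality because the sublevel set occupies a proportion at most `1` of
the ball. -/
theorem mono (h : IsPowGood μ L C R x₀ g) (hfin : ∀ x r, μ (Metric.ball x r) ≠ ⊤)
    {L' : ℕ} {C' R' : ℝ} (hL : L ≤ L') (hC : C ≤ C') (hC' : 0 ≤ C') (hR : R' ≤ R) :
    IsPowGood μ L' C' R' x₀ g := by
  intro x hx r hr hrR ε hε y hy
  have h1 := h x (hx.trans hR) r hr (hrR.trans hR) ε hε y hy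
  set m := μ.real {z ∈ Metric.ball x r | g z < ε} with hm
  set M := μ.real (Metric.ball x r) with hM
  have hmM : m ≤ M := measureReal_mono (fun z hz => hz.1) (hfin x r)
  have hm0 : 0 ≤ m := measureReal_nonneg
  have hM0 : 0 ≤ M := measureReal_nonneg
  obtain ⟨l, rfl⟩ := Nat.exists_eq_add_of_le hL
  calc m ^ (L + l) * g y = m ^ l * (m ^ L * g y) := by rw [pow_add]; ring
    _ ≤ m ^ l * (C' * ε * M ^ L) := by
      refine mul_le_mul_of_nonneg_left (h1.trans ?_) (by positivity)
      gcongr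
    _ ≤ M ^ l * (C' * ε * M ^ L) := by gcongr
    _ = C' * ε * M ^ (L + l) := by rw [pow_add]; ring

/-- Meant for projections: `N` is the measure of the fibre direction of a ball, and `D` the loss
when a ball is not exactly a product. Both sides have degree `L` in the measure, so only `D` enters
the constant. -/
theorem comp {φ : X → Y} {D : ℝ} {g : Y → ℝ} (h : IsPowGood ν L C R (φ x₀) g) (hC : 0 ≤ C)
    (hg : ∀ y, 0 ≤ g y) (hφ : ∀ x y, dist (φ x) (φ y) ≤ dist x y)
    (hμ : ∀ x r, 0 < r → ∃ N : ℝ, 0 ≤ N ∧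
      (∀ T ⊆ Metric.ball (φ x) r, μ.real {z ∈ Metric.ball x r | φ z ∈ T} ≤ N * ν.real T) ∧
      N * ν.real (Metric.ball (φ x) r) ≤ D * μ.real (Metric.ball x r)) :
    IsPowGood μ L (C * D ^ L) R x₀ (fun x => g (φ x)) := by
  intro x hx r hr hrR ε hε y hy
  obtain ⟨N, hN, hT, hB⟩ := hμ x r hr
  have h1 := h (φ x) ((hφ _ _).trans hx) r hr hrR ε hε (φ y) ((hφ _ _).trans_lt hy)
  have h2 : μ.real {z ∈ Metric.ball x r | g (φ z) < ε} ≤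
      N * ν.real {w ∈ Metric.ball (φ x) r | g w < ε} := by
    refine le_trans (le_of_eq ?_) (hT _ fun w hw => hw.1)
    congr 1
    ext z
    constructor
    · rintro ⟨hz, hgz⟩
      exact ⟨hz, (hφ _ _).trans_lt hz, hgz⟩
    · rintro ⟨hz, _, hgz⟩
      exact ⟨hz, hgz⟩
  have hgy := hg (φ y)
  calc μ.real {z ∈ Metric.ball x r | g (φ z) < ε} ^ L * g (φ y)
      ≤ (N * ν.real {w ∈ Metric.ball (φ x) r | g w < ε}) ^ L * g (φ y) := by gcongr
    _ = N ^ L * (ν.real {w ∈ Metric.ball (φ x) r | g w < ε} ^ L * g (φ y)) := by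
      rw [mul_pow]; ring
    _ ≤ N ^ L * (C * ε * ν.real (Metric.ball (φ x) r) ^ L) := by gcongr
    _ = C * ε * (N * ν.real (Metric.ball (φ x) r)) ^ L := by rw [mul_pow]; ring
    _ ≤ C * ε * (D * μ.real (Metric.ball x r)) ^ L := by gcongr
    _ = C * D ^ L * ε * μ.real (Metric.ball x r) ^ L := by rw [mul_pow]; ring

/-- A function comparable to the maximum of good functions is good. -/
theorem of_forall {κ : Type*} {G : κ → X → ℝ} {c : ℝ} (hfin : ∀ x r, μ (Metric.ball x r) ≠ ⊤)
    (h : ∀ i, IsPowGood μ L C R x₀ (G i)) (hc : 0 ≤ c) (hg : ∀ z, 0 ≤ g z)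
    (hle : ∀ i z, dist z x₀ < 2 * R → G i z ≤ g z)
    (hex : ∀ z, dist z x₀ < 2 * R → ∃ i, g z ≤ c * G i z) :
    IsPowGood μ L (c * C) R x₀ g := by
  intro x hx r hr hrR ε hε y hy
  have hdom : ∀ z ∈ Metric.ball x r, dist z x₀ < 2 * R := fun z hz => by
    rw [Metric.mem_ball] at hz
    linarith [dist_triangle z x x₀]
  -- The sublevel set of `g` lies in that of every `G i`, so the index may depend on `y`.
  obtain ⟨i, hi⟩ := hex y (hdom y hy)
  have h1 := h i x hx r hr hrR ε hε y hy
  have h2 : μ.real {z ∈ Metric.ball x r | g z < ε} ≤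
      μ.real {z ∈ Metric.ball x r | G i z < ε} := by
    refine measureReal_mono ?_ (ne_top_of_le_ne_top (hfin x r) (measure_mono fun z hz => hz.1))
    exact fun z hz => ⟨hz.1, (hle i z (hdom z hz.1)).trans_lt hz.2⟩
  have hgy := hg y
  calc μ.real {z ∈ Metric.ball x r | g z < ε} ^ L * g y
      ≤ μ.real {z ∈ Metric.ball x r | G i z < ε} ^ L * g y := by gcongr
    _ ≤ μ.real {z ∈ Metric.ball x r | G i z < ε} ^ L * (c * G i y) := by gcongr
    _ = c * (μ.real {z ∈ Metric.ball x r | G i z < ε} ^ L * G i y) := by ring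
    _ ≤ c * (C * ε * μ.real (Metric.ball x r) ^ L) := by gcongr
    _ = _ := by ring

theorem exists_uniform {κ Γ : Type*} [Finite κ] {G : κ → Γ → X → ℝ}
    (hfin : ∀ x r, μ (Metric.ball x r) ≠ ⊤)
    (h : ∀ i, ∃ (L : ℕ) (C R : ℝ), 0 < R ∧ ∀ γ, IsPowGood μ L C R x₀ (G i γ)) :
    ∃ (L : ℕ) (C R : ℝ), 1 ≤ L ∧ 1 ≤ C ∧ 0 < R ∧ ∀ i γ, IsPowGood μ L C R x₀ (G i γ) := by
  choose L C R hR hG using h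
  have := Fintype.ofFinite κ
  obtain ⟨R', hR', hR'R⟩ : ∃ R' : ℝ, 0 < R' ∧ ∀ i, R' ≤ R i := by
    have hev : ∀ᶠ R' in nhdsWithin (0 : ℝ) (Set.Ioi 0), 0 < R' ∧ ∀ i, R' ≤ R i :=
      eventually_mem_nhdsWithin.and
        (Filter.eventually_all.2 fun i => nhdsWithin_le_nhds (eventually_le_nhds (hR i)))
    exact hev.exists
  have hCsum : 0 ≤ ∑ i, |C i| := Finset.sum_nonneg fun i _ => abs_nonneg _
  refine ⟨∑ i, L i + 1, ∑ i, |C i| + 1, R', by omega, by linarith, hR', fun i γ => ?_⟩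
  refine (hG i γ).mono hfin ?_ ?_ (by linarith) (hR'R i)
  · exact (Finset.single_le_sum (f := L) (fun _ _ => Nat.zero_le _) (Finset.mem_univ i)).trans
      (Nat.le_succ _)
  · have := Finset.single_le_sum (f := fun i => |C i|) (fun _ _ => abs_nonneg _)
      (Finset.mem_univ i)
    linarith [le_abs_self (C i)]

end IsPowGood

/-- Take `L`-th roots; `1 ≤ C` allows `C ^ (1 / L)` to be replaced by `C`. The hypothesis `hrad` is
there because containment of balls as sets does not in general bound the radius. -/
theorem IsPowGood.isGood {X : Type*} [MetricSpace X] [MeasurableSpace X] {μ : Measure X} {L : ℕ}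
    {C R ρ : ℝ} {x₀ : X} {g : X → ℝ} (h : IsPowGood μ L C R x₀ g)
    (hfin : ∀ x r, μ (Metric.ball x r) ≠ ⊤) (hg : ∀ x, 0 ≤ g x) (hL : 1 ≤ L) (hC : 1 ≤ C)
    (hρ : ρ ≤ R) (hrad : ∀ x r, 0 < r → Metric.ball x r ⊆ Metric.ball x₀ ρ → r ≤ R)
    (hmeas : Measurable ((Metric.ball x₀ ρ).domRestrict g)) :
    IsGood μ C (1 / (L : ℝ)) (Metric.ball x₀ ρ) g := by
  refine ⟨hmeas, fun x _ r hr hsub ε hε => ?_⟩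
  have hx : dist x x₀ ≤ R := (Metric.mem_ball.1 (hsub (Metric.mem_ball_self hr))).le.trans hρ
  have hpow := h x hx r hr (hrad x r hr hsub) ε hε
  have hnorm : ∀ y, ‖g y‖ = g y := fun y => Real.norm_of_nonneg (hg y)
  simp only [hnorm]
  set m := μ {y ∈ Metric.ball x r | g y < ε} with hm
  set M := μ (Metric.ball x r) with hM
  have hMtop : M ≠ ⊤ := hfin x r
  have hmM : m ≤ M := measure_mono fun z hz => hz.1
  have hmtop : m ≠ ⊤ := ne_top_of_le_ne_top hMtop hmM
  rcases eq_or_ne M 0 with hM0 | hM0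
  · rw [hM0] at hmM
    rw [nonpos_iff_eq_zero.1 hmM]
    exact zero_le
  set σ : ℝ≥0∞ := ⨆ y ∈ Metric.ball x r, ‖g y‖ₑ with hσ
  have hC0 : ENNReal.ofReal C ≠ 0 := by
    rw [Ne, ENNReal.ofReal_eq_zero, not_le]; linarith
  have hε0 : ENNReal.ofReal ε ≠ 0 := by
    rw [Ne, ENNReal.ofReal_eq_zero, not_le]; exact hε
  have hσle : m ^ L * σ ≤ ENNReal.ofReal C * ENNReal.ofReal ε * M ^ L := by
    rw [hσ]
    simp only [ENNReal.mul_iSup]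
    refine iSup₂_le fun y hy => ?_
    have h1 := hpow y hy
    rw [← ENNReal.ofReal_toReal hmtop, ← ENNReal.ofReal_toReal hMtop,
      Real.enorm_of_nonneg (hg y), ← ENNReal.ofReal_pow ENNReal.toReal_nonneg,
      ← ENNReal.ofReal_pow ENNReal.toReal_nonneg, ← ENNReal.ofReal_mul (by positivity),
      ← ENNReal.ofReal_mul (by linarith), ← ENNReal.ofReal_mul (by positivity)]
    exact ENNReal.ofReal_le_ofReal h1
  have hσ' : m ^ L ≤ ENNReal.ofReal C * (ENNReal.ofReal ε / σ) * M ^ L := by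
    have hnum : ENNReal.ofReal C * ENNReal.ofReal ε * M ^ L ≠ 0 :=
      mul_ne_zero (mul_ne_zero hC0 hε0) (pow_ne_zero _ hM0)
    have hnum' : ENNReal.ofReal C * ENNReal.ofReal ε * M ^ L ≠ ⊤ :=
      ENNReal.mul_ne_top (ENNReal.mul_ne_top ENNReal.ofReal_ne_top ENNReal.ofReal_ne_top)
        (ENNReal.pow_ne_top hMtop)
    refine ((ENNReal.le_div_iff_mul_le (Or.inr hnum) (Or.inr hnum')).2 hσle).trans (le_of_eq ?_)
    simp only [div_eq_mul_inv]
    ring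
  have hα : (0 : ℝ) ≤ 1 / (L : ℝ) := by positivity
  have hLne : (L : ℝ) ≠ 0 := by exact_mod_cast (by omega : L ≠ 0)
  have hroot : ∀ t : ℝ≥0∞, (t ^ L) ^ (1 / (L : ℝ)) = t := fun t => by
    rw [← ENNReal.rpow_natCast, ← ENNReal.rpow_mul, mul_one_div_cancel hLne, ENNReal.rpow_one]
  have h2 := ENNReal.rpow_le_rpow hσ' hα
  rw [hroot, ENNReal.mul_rpow_of_nonneg _ _ hα, ENNReal.mul_rpow_of_nonneg _ _ hα, hroot] at h2
  refine h2.trans ?_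
  gcongr
  have h3 : (1 : ℝ≥0∞) ≤ ENNReal.ofReal C := by
    rw [← ENNReal.ofReal_one]; exact ENNReal.ofReal_le_ofReal hC
  calc ENNReal.ofReal C ^ (1 / (L : ℝ)) ≤ ENNReal.ofReal C ^ (1 : ℝ) := by
        refine ENNReal.rpow_le_rpow_of_exponent_le h3 ?_
        rw [div_le_one (by positivity)]
        exact_mod_cast hL
    _ = ENNReal.ofReal C := ENNReal.rpow_one _

/-! ### Projections that preserve goodness -/

section Projections

variable {X Y : Type*} [PseudoMetricSpace X] [MeasurableSpace X] [PseudoMetricSpace Y]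
  [MeasurableSpace Y] {μ : Measure X} {ν : Measure Y} {L : ℕ} {C R : ℝ}

/-- Balls of the maximum metric are products, so nothing is lost and `D = 1`. -/
theorem IsPowGood.comp_fst [SFinite μ] [SFinite ν] {x₀ : X × Y} {g : X → ℝ}
    (h : IsPowGood μ L C R x₀.1 g) (hC : 0 ≤ C) (hg : ∀ x, 0 ≤ g x) :
    IsPowGood (μ.prod ν) L C R x₀ (fun x => g x.1) := by
  have := h.comp (μ := μ.prod ν) (φ := Prod.fst) (D := 1) hC hg (fun x y => le_max_left _ _) ?_
  · simpa using this
  intro x r hr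
  refine ⟨ν.real (Metric.ball x.2 r), measureReal_nonneg, fun T hT => ?_, ?_⟩
  · have : {z ∈ Metric.ball x r | z.1 ∈ T} = T ×ˢ Metric.ball x.2 r := by
      ext z
      rw [show x = (x.1, x.2) from rfl, ← ball_prod_same]
      exact ⟨fun hz => ⟨hz.2, hz.1.2⟩, fun hz => ⟨⟨hT hz.1, hz.2⟩, hz.1⟩⟩
    rw [this, measureReal_prod_prod, mul_comm]
  · rw [show x = (x.1, x.2) from rfl, ← ball_prod_same, measureReal_prod_prod, one_mul, mul_comm]

theorem IsPowGood.comp_snd [SFinite μ] [SFinite ν] {x₀ : X × Y} {g : Y → ℝ}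
    (h : IsPowGood ν L C R x₀.2 g) (hC : 0 ≤ C) (hg : ∀ x, 0 ≤ g x) :
    IsPowGood (μ.prod ν) L C R x₀ (fun x => g x.2) := by
  have := h.comp (μ := μ.prod ν) (φ := Prod.snd) (D := 1) hC hg (fun x y => le_max_right _ _) ?_
  · simpa using this
  intro x r hr
  refine ⟨μ.real (Metric.ball x.1 r), measureReal_nonneg, fun T hT => ?_, ?_⟩
  · have : {z ∈ Metric.ball x r | z.2 ∈ T} = Metric.ball x.1 r ×ˢ T := by
      ext z
      rw [show x = (x.1, x.2) from rfl, ← ball_prod_same]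
      exact ⟨fun hz => ⟨hz.1.1, hz.2⟩, fun hz => ⟨⟨hz.1, hT hz.2⟩, hz.2⟩⟩
    rw [this, measureReal_prod_prod]
  · rw [show x = (x.1, x.2) from rfl, ← ball_prod_same, measureReal_prod_prod, one_mul]

theorem IsPowGood.comp_eval {κ : Type*} [Fintype κ] {Z : κ → Type*}
    [∀ p, PseudoMetricSpace (Z p)] [∀ p, MeasurableSpace (Z p)] {μ : ∀ p, Measure (Z p)}
    [∀ p, SigmaFinite (μ p)] {x₀ : ∀ p, Z p} (p : κ) {g : Z p → ℝ}
    (h : IsPowGood (μ p) L C R (x₀ p) g) (hC : 0 ≤ C) (hg : ∀ x, 0 ≤ g x) :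
    IsPowGood (Measure.pi μ) L C R x₀ (fun x => g (x p)) := by
  classical
  have := h.comp (μ := Measure.pi μ) (φ := fun x => x p) (D := 1) hC hg
    (fun x y => dist_le_pi_dist x y p) ?_
  · simpa using this
  intro x r hr
  refine ⟨∏ q ∈ Finset.univ.erase p, (μ q).real (Metric.ball (x q) r),
    Finset.prod_nonneg fun _ _ => measureReal_nonneg, fun T hT => ?_, ?_⟩
  · have : {z ∈ Metric.ball x r | z p ∈ T} =
        Set.pi Set.univ (Function.update (fun q => Metric.ball (x q) r) p T) := by
      ext z
      rw [ball_pi x hr]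
      constructor
      · rintro ⟨hz, hzT⟩ q -
        rcases eq_or_ne q p with rfl | hq
        · simpa using hzT
        · rw [Function.update_of_ne hq]
          exact hz q trivial
      · intro hz
        have hzT : z p ∈ T := by simpa using hz p trivial
        refine ⟨fun q _ => ?_, hzT⟩
        rcases eq_or_ne q p with rfl | hq
        · exact hT hzT
        · have := hz q trivial
          rwa [Function.update_of_ne hq] at this
    rw [this, Measure.real, Measure.pi_pi, ENNReal.toReal_prod,
      ← Finset.mul_prod_erase _ _ (Finset.mem_univ p), Function.update_self, mul_comm]
    refine le_of_eq (congrArg (· * _) (Finset.prod_congr rfl fun q hq => ?_))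
    rw [Function.update_of_ne (Finset.ne_of_mem_erase hq)]
    rfl
  · rw [ball_pi x hr, one_mul, Measure.real, Measure.real, Measure.pi_pi, ENNReal.toReal_prod,
      ← Finset.mul_prod_erase _ _ (Finset.mem_univ p), mul_comm]
    rfl

/-- A supremum ball contains the Euclidean ball of the same radius and lies in one larger by a
dimensional factor; doubling turns this into the loss `D`. -/
theorem exists_isPowGood_comp_ofLp (d L : ℕ) : ∃ D : ℝ, 0 < D ∧
    ∀ {C R : ℝ} {x₀ : EuclideanSpace ℝ (Fin d)} {g : (Fin d → ℝ) → ℝ}, 0 ≤ C → (∀ x, 0 ≤ g x) →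
      IsPowGood (Measure.pi fun _ : Fin d => (volume : Measure ℝ)) L C R x₀.ofLp g →
      IsPowGood volume L (C * D ^ L) R x₀ (fun x => g x.ofLp) := by
  have hanti := PiLp.antilipschitzWith_ofLp 2 (fun _ : Fin d => ℝ)
  have hlip := PiLp.lipschitzWith_ofLp 2 (fun _ : Fin d => ℝ)
  set c : NNReal := (Fintype.card (Fin d) : NNReal) ^ (1 / (2 : ℝ≥0∞)).toReal with hc
  obtain ⟨D, hD, hdoub⟩ := exists_measureReal_closedBall_le
    (volume : Measure (EuclideanSpace ℝ (Fin d))) ℝ c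
  have hpre : ∀ T : Set (Fin d → ℝ), (volume : Measure (EuclideanSpace ℝ (Fin d))).real
      ((MeasurableEquiv.toLp 2 (Fin d → ℝ)).symm ⁻¹' T) =
      (Measure.pi fun _ : Fin d => (volume : Measure ℝ)).real T := by
    intro T
    rw [Measure.real, Measure.real]
    congr 1
    exact (EuclideanSpace.volume_preserving_symm_measurableEquiv_toLp (Fin d)).measure_preimage_equiv T
  refine ⟨D, hD, fun {C R x₀ g} hC hg h => h.comp (φ := fun x : EuclideanSpace ℝ (Fin d) => x.ofLp) (D := D) hC hg ?_ ?_⟩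
  · intro x y
    simpa using hlip.dist_le_mul x y
  · intro x r hr
    have hsub : (MeasurableEquiv.toLp 2 (Fin d → ℝ)).symm ⁻¹' (Metric.ball x.ofLp r) ⊆
        Metric.closedBall x (c * r) := by
      intro z hz
      have h1 := hanti.le_mul_dist z x
      have h2 : dist z.ofLp x.ofLp < r := hz
      rw [Metric.mem_closedBall]
      refine h1.trans ?_
      gcongr
    refine ⟨1, zero_le_one, fun T hT => ?_, ?_⟩
    · rw [one_mul, ← hpre T]
      refine measureReal_mono (fun z hz => hz.2) ?_
      exact ne_top_of_le_ne_top measure_closedBall_lt_top.ne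
        (measure_mono ((Set.preimage_mono hT).trans hsub))
    · rw [one_mul, ← hpre]
      exact (measureReal_mono hsub measure_closedBall_lt_top.ne).trans (hdoub x r hr)

end Projections

end PowGood

/-! ### Values and gradients at one place. -/

section OnePlaceFamilies

variable {K : Type*} [NontriviallyNormedField K]

theorem dotAdd_analyticAt {d n : ℕ} {f : Fin n → (Fin d → K) → K} {Θ : (Fin d → K) → K}
    {x : Fin d → K} (hf : ∀ j, AnalyticAt K (f j) x) (hΘ : AnalyticAt K Θ x) (a : Fin n → ℤ) :
    AnalyticAt K (dotAdd a f Θ) x := by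
  unfold dotAdd
  exact (Finset.analyticAt_fun_sum _ fun j _ => analyticAt_const.mul (hf j)).add hΘ

theorem grad_dotAdd {d n : ℕ} {f : Fin n → (Fin d → K) → K} {Θ : (Fin d → K) → K}
    {x : Fin d → K} (hf : ∀ j, DifferentiableAt K (f j) x) (hΘ : DifferentiableAt K Θ x)
    (a : Fin n → ℤ) (i : Fin d) :
    grad (dotAdd a f Θ) x i = (∑ j, (a j : K) * grad (f j) x i) + grad Θ x i := by
  have h : HasFDerivAt (dotAdd a f Θ) ((∑ j, (a j : K) • fderiv K (f j) x) + fderiv K Θ x) x :=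
    (HasFDerivAt.fun_sum fun j _ => (hf j).hasFDerivAt.const_mul (a j : K)).add hΘ.hasFDerivAt
  simp [grad, h.fderiv]

theorem norm_grad_le_gradNorm {d : ℕ} (q : ℝ≥0∞) [Fact (1 ≤ q)] (g : (Fin d → K) → K)
    (x : Fin d → K) (i : Fin d) : ‖grad g x i‖ ≤ gradNorm q g x :=
  PiLp.norm_apply_le (WithLp.toLp q (grad g x) : PiLp q (fun _ : Fin d => K)) i

theorem PiLp.norm_toLp_le_sum {d : ℕ} (q : ℝ≥0∞) [Fact (1 ≤ q)] (v : Fin d → K) :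
    ‖(WithLp.toLp q v : PiLp q (fun _ : Fin d => K))‖ ≤ ∑ i, ‖v i‖ := by
  have h : (WithLp.toLp q v : PiLp q (fun _ : Fin d => K)) =
      ∑ i, WithLp.toLp q (Pi.single i (v i)) := by
    rw [← WithLp.toLp_sum, Finset.univ_sum_single]
  rw [h]
  refine norm_sum_le_of_le _ fun i _ => ?_
  exact (PiLp.norm_single q (fun _ : Fin d => K) i (v i)).le

/-- With `norm_grad_le_gradNorm`, this makes the gradient norm comparable to the largest partial
derivative, as `IsPowGood.of_forall` requires. -/
theorem exists_gradNorm_le {d : ℕ} (hd : 1 ≤ d) (q : ℝ≥0∞) [Fact (1 ≤ q)]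
    (g : (Fin d → K) → K) (x : Fin d → K) : ∃ i, gradNorm q g x ≤ d * ‖grad g x i‖ := by
  have : Nonempty (Fin d) := ⟨⟨0, hd⟩⟩
  obtain ⟨i, hi⟩ := Finite.exists_max fun i => ‖grad g x i‖
  refine ⟨i, (PiLp.norm_toLp_le_sum q (grad g x)).trans ?_⟩
  simpa using Finset.sum_le_card_nsmul Finset.univ (fun i => ‖grad g x i‖) _ fun j _ => hi j

theorem continuousAt_gradNorm [CompleteSpace K] {d : ℕ} (q : ℝ≥0∞) [Fact (1 ≤ q)]
    {g : (Fin d → K) → K} {x : Fin d → K} (hg : AnalyticAt K g x) :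
    ContinuousAt (gradNorm q g) x := by
  have h1 : ContinuousAt (grad g) x :=
    continuousAt_pi.2 fun i => hg.fderiv.continuousAt.clm_apply continuousAt_const
  exact ((PiLp.continuous_toLp q fun _ : Fin d => K).continuousAt.comp h1).norm

variable [ProperSpace K] [MeasurableSpace K] [BorelSpace K]
  (μ : Measure K) [μ.IsAddHaarMeasure] {d n : ℕ} {f : Fin n → (Fin d → K) → K}
  {Θ : (Fin d → K) → K} {x₀ : Fin d → K}

theorem exists_isPowGood_of_analyticAt {ι : Type*} [Fintype ι] {h : ι → (Fin d → K) → K}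
    (hh : ∀ j, AnalyticAt K (h j) x₀) :
    ∃ (L : ℕ) (C R : ℝ), 0 < R ∧ ∀ c : ι → K,
      IsPowGood (Measure.pi fun _ : Fin d => μ) L C R x₀ (fun z => ‖∑ j, c j * h j z‖) := by
  obtain ⟨L, R, C, -, hR, -, H⟩ := exists_good_of_analyticAt μ hh
  exact ⟨L, C, R, hR, fun c x hx r hr hrR ε hε y hy =>
    H c x (by rwa [← dist_eq_norm]) r hr hrR ε hε y hy⟩

theorem exists_isPowGood_dotAdd (hf : ∀ j, AnalyticAt K (f j) x₀) (hΘ : AnalyticAt K Θ x₀) :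
    ∃ (L : ℕ) (C R : ℝ), 0 < R ∧ ∀ γ : ℤ × (Fin n → ℤ),
      IsPowGood (Measure.pi fun _ : Fin d => μ) L C R x₀
        (fun z => ‖(γ.1 : K) + dotAdd γ.2 f Θ z‖) := by
  -- The family consists of `1`, `Θ` and the `f j`; the coefficient of `Θ` will be `1`.
  let h : Option (Option (Fin n)) → (Fin d → K) → K := fun j =>
    j.elim (fun _ => 1) fun j => j.elim Θ f
  obtain ⟨L, C, R, hR, H⟩ := exists_isPowGood_of_analyticAt (x₀ := x₀) μ (h := h) (by
    rintro (_ | _ | j)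
    · exact analyticAt_const
    · exact hΘ
    · exact hf j)
  refine ⟨L, C, R, hR, fun γ => ?_⟩
  convert H (fun j => j.elim (γ.1 : K) fun j => j.elim 1 fun j => (γ.2 j : K)) using 3 with z
  simp [h, dotAdd, Fintype.sum_option, add_comm]

theorem exists_isPowGood_gradNorm (hd : 1 ≤ d) (q : ℝ≥0∞) [Fact (1 ≤ q)]
    (hf : ∀ j, AnalyticAt K (f j) x₀) (hΘ : AnalyticAt K Θ x₀) :
    ∃ (L : ℕ) (C R : ℝ), 0 < R ∧ ∀ γ : ℤ × (Fin n → ℤ),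
      IsPowGood (Measure.pi fun _ : Fin d => μ) L C R x₀
        (fun z => gradNorm q (dotAdd γ.2 f Θ) z) := by
  have hfin : ∀ (x : Fin d → K) r, (Measure.pi fun _ : Fin d => μ) (Metric.ball x r) ≠ ⊤ :=
    fun x r => measure_ball_lt_top.ne
  have hpart : ∀ {g : (Fin d → K) → K} (i : Fin d), AnalyticAt K g x₀ →
      AnalyticAt K (fun z => grad g z i) x₀ := fun i hg =>
    
    ((ContinuousLinearMap.apply K K (Pi.single i 1 : Fin d → K)).analyticAt _).comp hg.fderiv
  have h1 : ∀ i : Fin d, ∃ (L : ℕ) (C R : ℝ), 0 < R ∧ ∀ γ : ℤ × (Fin n → ℤ),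
      IsPowGood (Measure.pi fun _ : Fin d => μ) L C R x₀
        (fun z => ‖(∑ j, (γ.2 j : K) * grad (f j) z i) + grad Θ z i‖) := by
    intro i
    let h : Option (Fin n) → (Fin d → K) → K := fun j =>
      j.elim (fun z => grad Θ z i) fun j z => grad (f j) z i
    obtain ⟨L, C, R, hR, H⟩ := exists_isPowGood_of_analyticAt (x₀ := x₀) μ (h := h) (by
      rintro (_ | j)
      · exact hpart i hΘ
      · exact hpart i (hf j))
    refine ⟨L, C, R, hR, fun γ => ?_⟩
    convert H (fun j => j.elim 1 fun j => (γ.2 j : K)) using 3 with z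
    simp [h, Fintype.sum_option, add_comm]
  obtain ⟨L, C, R, -, hC, hR, H⟩ := IsPowGood.exists_uniform hfin h1
  have hev : ∀ᶠ z in nhds x₀, (∀ j, AnalyticAt K (f j) z) ∧ AnalyticAt K Θ z :=
    (Filter.eventually_all.2 fun j => (hf j).eventually_analyticAt).and hΘ.eventually_analyticAt
  obtain ⟨R₁, hR₁, hball⟩ := Metric.eventually_nhds_iff_ball.1 hev
  -- The gradient is additive only where all functions are differentiable; the balls involved reach
  -- up to twice the radius, hence `R₁ / 2`.
  refine ⟨L, d * C, min R (R₁ / 2), by positivity, fun γ => ?_⟩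
  have hgrad : ∀ z, dist z x₀ < 2 * min R (R₁ / 2) → ∀ i, grad (dotAdd γ.2 f Θ) z i =
      (∑ j, (γ.2 j : K) * grad (f j) z i) + grad Θ z i := by
    intro z hz i
    have := hball z (by
      rw [Metric.mem_ball]
      linarith [min_le_right R (R₁ / 2)])
    exact grad_dotAdd (fun j => (this.1 j).differentiableAt) this.2.differentiableAt γ.2 i
  refine IsPowGood.of_forall hfin
    (fun i => (H i γ).mono hfin le_rfl le_rfl (by linarith) (min_le_left _ _)) (by positivity)
    (fun z => norm_nonneg _) (fun i z hz => ?_) (fun z hz => ?_)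
  · rw [← hgrad z hz i]
    exact norm_grad_le_gradNorm q _ z i
  · obtain ⟨i, hi⟩ := exists_gradNorm_le hd q (dotAdd γ.2 f Θ) z
    rw [hgrad z hz i] at hi
    exact ⟨i, hi⟩

end OnePlaceFamilies

/-! ### Transfer to the `S`-adic space. -/

section SAdic

instance isAddHaarMeasure_padicHaar (p : ℕ) [Fact p.Prime] : (padicHaar p).IsAddHaarMeasure := by
  unfold padicHaar
  infer_instance

variable {S : Finset Nat.Primes} {d₀ : ℕ} {d : S → ℕ}

instance isFiniteMeasureOnCompacts_sMeasure :
    IsFiniteMeasureOnCompacts (sMeasure S d₀ d) := by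
  unfold sMeasure
  infer_instance

theorem sMeasure_ball_ne_top (x : SSpace S d₀ d) (r : ℝ) :
    sMeasure S d₀ d (Metric.ball x r) ≠ ⊤ :=
  measure_ball_lt_top.ne

theorem exists_isPowGood_sMeasure_infinite {Γ : Type*} {g : Γ → (Fin d₀ → ℝ) → ℝ}
    {x₀ : SSpace S d₀ d} (hg : ∀ γ x, 0 ≤ g γ x)
    (h : ∃ (L : ℕ) (C R : ℝ), 0 < R ∧ ∀ γ,
      IsPowGood (Measure.pi fun _ : Fin d₀ => (volume : Measure ℝ)) L C R x₀.1.ofLp (g γ)) :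
    ∃ (L : ℕ) (C R : ℝ), 0 < R ∧ ∀ γ,
      IsPowGood (sMeasure S d₀ d) L C R x₀ (fun x => g γ x.1.ofLp) := by
  obtain ⟨L, C, R, hR, H⟩ := h
  obtain ⟨D, hD, hcomp⟩ := exists_isPowGood_comp_ofLp d₀ L
  refine ⟨L, |C| * D ^ L, R, hR, fun γ => ?_⟩
  have h1 := (H γ).mono (fun x r => measure_ball_lt_top.ne) le_rfl (le_abs_self C) (abs_nonneg C)
    le_rfl
  exact (hcomp (abs_nonneg C) (hg γ) h1).comp_fst (by positivity) fun x => hg γ _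

theorem exists_isPowGood_sMeasure_finite {Γ : Type*} (p : S)
    {g : Γ → (Fin (d p) → ℚ_[(p : Nat.Primes)]) → ℝ}
    {x₀ : SSpace S d₀ d} (hg : ∀ γ x, 0 ≤ g γ x)
    (h : ∃ (L : ℕ) (C R : ℝ), 0 < R ∧ ∀ γ,
      IsPowGood (Measure.pi fun _ : Fin (d p) => padicHaar (p : Nat.Primes)) L C R (x₀.2 p) (g γ)) :
    ∃ (L : ℕ) (C R : ℝ), 0 < R ∧ ∀ γ,
      IsPowGood (sMeasure S d₀ d) L C R x₀ (fun x => g γ (x.2 p)) := by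
  obtain ⟨L, C, R, hR, H⟩ := h
  refine ⟨L, |C|, R, hR, fun γ => ?_⟩
  have h1 := (H γ).mono (fun x r => measure_ball_lt_top.ne) le_rfl (le_abs_self C) (abs_nonneg C)
    le_rfl
  exact (IsPowGood.comp_eval (μ := fun q : S => Measure.pi fun _ : Fin (d q) =>
    padicHaar (q : Nat.Primes)) p h1 (abs_nonneg C) (hg γ)).comp_snd (abs_nonneg C) fun x => hg γ _

theorem IsOpenBox.isOpen {K : Type*} [NontriviallyNormedField K] {d : ℕ} {U : Set (Fin d → K)}
    (hU : IsOpenBox U) : IsOpen U := by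
  obtain ⟨c, r, -, rfl⟩ := hU
  exact isOpen_set_pi Set.finite_univ fun i _ => Metric.isOpen_ball

theorem isOpen_sProd {U₀ : Set (Fin d₀ → ℝ)}
    {U : ∀ p : S, Set (Fin (d p) → ℚ_[(p : Nat.Primes)])} (hU₀ : IsOpen U₀)
    (hU : ∀ p, IsOpen (U p)) : IsOpen (sProd U₀ U) := by
  have h1 : IsOpen {x : SSpace S d₀ d | x.1.ofLp ∈ U₀} :=
    hU₀.preimage ((PiLp.continuous_ofLp 2 _).comp continuous_fst)
  have h2 : IsOpen (⋂ p, {x : SSpace S d₀ d | x.2 p ∈ U p}) :=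
    isOpen_iInter_of_finite fun p => (hU p).preimage ((continuous_apply p).comp continuous_snd)
  convert h1.inter h2 using 1
  ext x
  simp [sProd]

/-- The infinite place bounds the radius of a ball contained in a given ball. -/
theorem le_two_mul_of_ball_subset_ball (hd₀ : 1 ≤ d₀) {x x₀ : SSpace S d₀ d} {r ρ : ℝ} (hr : 0 < r)
    (hsub : Metric.ball x r ⊆ Metric.ball x₀ ρ) : r ≤ 2 * ρ := by
  refine le_of_forall_lt_imp_le_of_dense fun t ht => ?_
  rcases le_or_gt t 0 with h0 | h0
  · have : 0 < ρ := Metric.pos_of_mem_ball (hsub (Metric.mem_ball_self hr))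
    linarith
  set e : EuclideanSpace ℝ (Fin d₀) := EuclideanSpace.single ⟨0, hd₀⟩ t with he
  have hen : ‖e‖ = t := by rw [he, PiLp.norm_single, Real.norm_of_nonneg h0.le]
  have hy : (x.1 + e, x.2) ∈ Metric.ball x r := by
    rw [Metric.mem_ball, Prod.dist_eq]
    simp [hen, ht, hr]
  have h1 := Metric.mem_ball.1 (hsub hy)
  have h2 := Metric.mem_ball.1 (hsub (Metric.mem_ball_self hr))
  have h3 : t ≤ dist (x.1 + e, x.2) x := by
    rw [Prod.dist_eq]
    simp [hen]
  linarith [dist_triangle_right (x.1 + e, x.2) x x₀]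

theorem sAbs_nonneg (y : QS S) : 0 ≤ sAbs y := (abs_nonneg _).trans (le_max_left _ _)

theorem abs_fst_le_sAbs (y : QS S) : |y.1| ≤ sAbs y := le_max_left _ _

theorem norm_snd_le_sAbs (y : QS S) (p : S) : ‖y.2 p‖ ≤ sAbs y :=
  (le_ciSup (f := fun p : S => ‖y.2 p‖) (Set.finite_range _).bddAbove p).trans (le_max_right _ _)

theorem sAbs_eq (y : QS S) : sAbs y = |y.1| ∨ ∃ p, sAbs y = ‖y.2 p‖ := by
  rcases le_total (⨆ p : S, ‖y.2 p‖) |y.1| with h | h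
  · exact Or.inl (max_eq_left h)
  -- Without finite places the supremum takes the default value `0`, which the real absolute value
  -- dominates.
  · rcases isEmpty_or_nonempty S with hS | hS
    · left
      refine max_eq_left ?_
      rw [Real.iSup_of_isEmpty]
      exact abs_nonneg _
    · obtain ⟨p, hp⟩ := exists_eq_ciSup_of_finite (f := fun p : S => ‖y.2 p‖)
      exact Or.inr ⟨p, (max_eq_right h).trans hp.symm⟩

theorem continuous_sAbs : Continuous (sAbs : QS S → ℝ) := by
  rcases isEmpty_or_nonempty S with hS | hS
  · have : (sAbs : QS S → ℝ) = fun y => |y.1| := by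
      ext y
      rcases sAbs_eq y with h | ⟨p, -⟩
      · exact h
      · exact hS.elim p
    rw [this]
    fun_prop
  · have : (sAbs : QS S → ℝ) = fun y => max |y.1| (Finset.univ.sup' Finset.univ_nonempty
        fun p : S => ‖y.2 p‖) := by
      ext y
      rw [Finset.sup'_univ_eq_ciSup]
      rfl
    rw [this]
    refine (continuous_abs.comp continuous_fst).max ?_
    exact Continuous.finset_sup'_apply _ fun p _ => by fun_prop

/-! ### The functions of interest, as functions on the `S`-adic space -/

section Components

variable {n : ℕ} {x₀ : SSpace S d₀ d}

theorem exists_isPowGood_value_infinite {f₀ : Fin n → (Fin d₀ → ℝ) → ℝ} {Θ₀ : (Fin d₀ → ℝ) → ℝ}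
    (hf : ∀ j, AnalyticAt ℝ (f₀ j) x₀.1.ofLp) (hΘ : AnalyticAt ℝ Θ₀ x₀.1.ofLp) :
    ∃ (L : ℕ) (C R : ℝ), 0 < R ∧ ∀ γ : ℤ × (Fin n → ℤ),
      IsPowGood (sMeasure S d₀ d) L C R x₀
        (fun x => ‖(γ.1 : ℝ) + dotAdd γ.2 f₀ Θ₀ x.1.ofLp‖) :=
  exists_isPowGood_sMeasure_infinite (fun _ _ => norm_nonneg _)
    (exists_isPowGood_dotAdd volume hf hΘ)

theorem exists_isPowGood_gradNorm_infinite (hd₀ : 1 ≤ d₀) {f₀ : Fin n → (Fin d₀ → ℝ) → ℝ}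
    {Θ₀ : (Fin d₀ → ℝ) → ℝ}
    (hf : ∀ j, AnalyticAt ℝ (f₀ j) x₀.1.ofLp) (hΘ : AnalyticAt ℝ Θ₀ x₀.1.ofLp) :
    ∃ (L : ℕ) (C R : ℝ), 0 < R ∧ ∀ γ : ℤ × (Fin n → ℤ),
      IsPowGood (sMeasure S d₀ d) L C R x₀
        (fun x => gradNorm 2 (dotAdd γ.2 f₀ Θ₀) x.1.ofLp) :=
  exists_isPowGood_sMeasure_infinite (fun _ _ => norm_nonneg _)
    (exists_isPowGood_gradNorm volume hd₀ 2 hf hΘ)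

theorem exists_isPowGood_value_finite (p : S)
    {f : Fin n → (Fin (d p) → ℚ_[(p : Nat.Primes)]) → ℚ_[(p : Nat.Primes)]}
    {Θ : (Fin (d p) → ℚ_[(p : Nat.Primes)]) → ℚ_[(p : Nat.Primes)]}
    (hf : ∀ j, AnalyticAt ℚ_[(p : Nat.Primes)] (f j) (x₀.2 p))
    (hΘ : AnalyticAt ℚ_[(p : Nat.Primes)] Θ (x₀.2 p)) :
    ∃ (L : ℕ) (C R : ℝ), 0 < R ∧ ∀ γ : ℤ × (Fin n → ℤ),
      IsPowGood (sMeasure S d₀ d) L C R x₀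
        (fun x => ‖(γ.1 : ℚ_[(p : Nat.Primes)]) + dotAdd γ.2 f Θ (x.2 p)‖) :=
  exists_isPowGood_sMeasure_finite p
    (g := fun (γ : ℤ × (Fin n → ℤ)) z => ‖(γ.1 : ℚ_[(p : Nat.Primes)]) + dotAdd γ.2 f Θ z‖)
    (fun _ _ => norm_nonneg _) (exists_isPowGood_dotAdd (padicHaar (p : Nat.Primes)) hf hΘ)

theorem exists_isPowGood_gradNorm_finite (p : S) (hd : 1 ≤ d p)
    {f : Fin n → (Fin (d p) → ℚ_[(p : Nat.Primes)]) → ℚ_[(p : Nat.Primes)]}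
    {Θ : (Fin (d p) → ℚ_[(p : Nat.Primes)]) → ℚ_[(p : Nat.Primes)]}
    (hf : ∀ j, AnalyticAt ℚ_[(p : Nat.Primes)] (f j) (x₀.2 p))
    (hΘ : AnalyticAt ℚ_[(p : Nat.Primes)] Θ (x₀.2 p)) :
    ∃ (L : ℕ) (C R : ℝ), 0 < R ∧ ∀ γ : ℤ × (Fin n → ℤ),
      IsPowGood (sMeasure S d₀ d) L C R x₀
        (fun x => gradNorm ∞ (dotAdd γ.2 f Θ) (x.2 p)) :=
  exists_isPowGood_sMeasure_finite p (g := fun (γ : ℤ × (Fin n → ℤ)) z => gradNorm ∞ (dotAdd γ.2 f Θ) z)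
    (fun _ _ => norm_nonneg _) (exists_isPowGood_gradNorm (padicHaar (p : Nat.Primes)) hd ∞ hf hΘ)

/-- The components at the single places are good, and `sAbs` is exactly their maximum. -/
theorem exists_isPowGood_sAbs {f₀ : Fin n → (Fin d₀ → ℝ) → ℝ} {Θ₀ : (Fin d₀ → ℝ) → ℝ}
    {f : ∀ p : S, Fin n → (Fin (d p) → ℚ_[(p : Nat.Primes)]) → ℚ_[(p : Nat.Primes)]}
    {Θ : ∀ p : S, (Fin (d p) → ℚ_[(p : Nat.Primes)]) → ℚ_[(p : Nat.Primes)]}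
    (hf₀ : ∀ j, AnalyticAt ℝ (f₀ j) x₀.1.ofLp) (hΘ₀ : AnalyticAt ℝ Θ₀ x₀.1.ofLp)
    (hf : ∀ p : S, ∀ j, AnalyticAt ℚ_[(p : Nat.Primes)] (f p j) (x₀.2 p))
    (hΘ : ∀ p : S, AnalyticAt ℚ_[(p : Nat.Primes)] (Θ p) (x₀.2 p)) :
    ∃ (L : ℕ) (C R : ℝ), 0 < R ∧ ∀ γ : ℤ × (Fin n → ℤ),
      IsPowGood (sMeasure S d₀ d) L C R x₀ (fun x => sAbs ((γ.1 : QS S) +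
        sMap (dotAdd γ.2 f₀ Θ₀) (fun p => dotAdd γ.2 (f p) (Θ p)) x)) := by
  let G : Option S → ℤ × (Fin n → ℤ) → SSpace S d₀ d → ℝ
    | none => fun γ x => ‖(γ.1 : ℝ) + dotAdd γ.2 f₀ Θ₀ x.1.ofLp‖
    | some p => fun γ x => ‖(γ.1 : ℚ_[(p : Nat.Primes)]) + dotAdd γ.2 (f p) (Θ p) (x.2 p)‖
  have hG : ∀ i : Option S, ∃ (L : ℕ) (C R : ℝ), 0 < R ∧ ∀ γ : ℤ × (Fin n → ℤ),
      IsPowGood (sMeasure S d₀ d) L C R x₀ (G i γ)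
    | none => exists_isPowGood_value_infinite hf₀ hΘ₀
    | some p => exists_isPowGood_value_finite p (hf p) (hΘ p)
  obtain ⟨L, C, R, -, -, hR, H⟩ := IsPowGood.exists_uniform sMeasure_ball_ne_top hG
  refine ⟨L, 1 * C, R, hR, fun γ => IsPowGood.of_forall sMeasure_ball_ne_top (fun i => H i γ)
    zero_le_one (fun _ => sAbs_nonneg _) ?_ fun z _ => ?_⟩
  · rintro (_ | p) z -
    · exact abs_fst_le_sAbs ((γ.1 : QS S) +
        sMap (dotAdd γ.2 f₀ Θ₀) (fun p => dotAdd γ.2 (f p) (Θ p)) z)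
    · exact norm_snd_le_sAbs ((γ.1 : QS S) +
        sMap (dotAdd γ.2 f₀ Θ₀) (fun p => dotAdd γ.2 (f p) (Θ p)) z) p
  · simp only [one_mul]
    rcases sAbs_eq ((γ.1 : QS S) +
      sMap (dotAdd γ.2 f₀ Θ₀) (fun p => dotAdd γ.2 (f p) (Θ p)) z) with h | ⟨p, h⟩
    · exact ⟨none, h.le⟩
    · exact ⟨some p, h.le⟩

end Components

end SAdic

/-! ### Assembly of the theorem. -/

theorem corollary3p6 (S : Finset Nat.Primes) (n d₀ : ℕ) (d : S → ℕ)
    (hd₀ : 1 ≤ d₀) (hd : ∀ p, 1 ≤ d p)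
    (U₀ : Set (Fin d₀ → ℝ)) (U : ∀ p : S, Set (Fin (d p) → ℚ_[(p : Nat.Primes)]))
    (hU₀ : IsOpenBox U₀) (hU : ∀ p, IsOpenBox (U p))
    (f₀ : Fin n → (Fin d₀ → ℝ) → ℝ)
    (f : ∀ p : S, Fin n → (Fin (d p) → ℚ_[(p : Nat.Primes)]) → ℚ_[(p : Nat.Primes)])
    (Θ₀ : (Fin d₀ → ℝ) → ℝ)
    (Θ : ∀ p : S, (Fin (d p) → ℚ_[(p : Nat.Primes)]) → ℚ_[(p : Nat.Primes)])
    (hf₀ : ∀ j, NormalizedAnalytic 2 U₀ (f₀ j))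
    (hf : ∀ p, ∀ j, NormalizedAnalytic ∞ (U p) (f p j))
    (hli₀ : LocallyLinIndep U₀ f₀) (hli : ∀ p, LocallyLinIndep (U p) (f p))
    (hΘ₀ : NormalizedAnalytic 2 U₀ Θ₀) (hΘ : ∀ p, NormalizedAnalytic ∞ (U p) (Θ p))
    (x₀ : SSpace S d₀ d) (hx₀ : x₀ ∈ sProd U₀ U) :
    ∃ V : Set (SSpace S d₀ d), IsOpen V ∧ x₀ ∈ V ∧ V ⊆ sProd U₀ U ∧
      ∃ C : ℝ, 0 < C ∧ ∃ k k₁ : ℕ, 1 ≤ k ∧ 1 ≤ k₁ ∧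
        ∀ (a₀ : ℤ) (a : Fin n → ℤ),
          IsGood (sMeasure S d₀ d) C
            (1 / (((max d₀ (Finset.univ.sup d) : ℕ) : ℝ) * (k : ℝ))) V
            (fun x => sAbs ((a₀ : QS S) +
              sMap (dotAdd a f₀ Θ₀) (fun p => dotAdd a (f p) (Θ p)) x)) ∧
          IsGood (sMeasure S d₀ d) C
            (1 / (((max d₀ (Finset.univ.sup d) : ℕ) : ℝ) * (k₁ : ℝ))) V
            (fun x => gradNorm 2 (dotAdd a f₀ Θ₀) x.1.ofLp) ∧
          ∀ p : S, IsGood (sMeasure S d₀ d) C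
            (1 / (((max d₀ (Finset.univ.sup d) : ℕ) : ℝ) * (k₁ : ℝ))) V
            (fun x => gradNorm ∞ (dotAdd a (f p) (Θ p)) (x.2 p)) := by
  have han₀ : ∀ x ∈ U₀, (∀ j, AnalyticAt ℝ (f₀ j) x) ∧ AnalyticAt ℝ Θ₀ x := fun x hx =>
    ⟨fun j => (hf₀ j).analytic.1 x hx, hΘ₀.analytic.1 x hx⟩
  have han : ∀ p, ∀ x ∈ U p, (∀ j, AnalyticAt ℚ_[(p : Nat.Primes)] (f p j) x) ∧
      AnalyticAt ℚ_[(p : Nat.Primes)] (Θ p) x := fun p x hx =>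
    ⟨fun j => (hf p j).analytic.1 x hx, (hΘ p).analytic.1 x hx⟩
  have hfin := sMeasure_ball_ne_top (S := S) (d₀ := d₀) (d := d)
  have hopen : IsOpen (sProd U₀ U) := isOpen_sProd hU₀.isOpen fun p => (hU p).isOpen
  have hx₁ := han₀ _ hx₀.1
  have hx₂ := fun p => han p _ (hx₀.2 p)
  -- All the functions in the conclusion form one finite family with common parameters, so that `L`,
  -- `C` and `R` can be chosen uniformly.
  let G : Option (Option S) → ℤ × (Fin n → ℤ) → SSpace S d₀ d → ℝ
    | none => fun γ x => sAbs ((γ.1 : QS S) +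
        sMap (dotAdd γ.2 f₀ Θ₀) (fun p => dotAdd γ.2 (f p) (Θ p)) x)
    | some none => fun γ x => gradNorm 2 (dotAdd γ.2 f₀ Θ₀) x.1.ofLp
    | some (some p) => fun γ x => gradNorm ∞ (dotAdd γ.2 (f p) (Θ p)) (x.2 p)
  have hG : ∀ i, ∃ (L : ℕ) (C R : ℝ), 0 < R ∧ ∀ γ : ℤ × (Fin n → ℤ),
      IsPowGood (sMeasure S d₀ d) L C R x₀ (G i γ)
    | none => exists_isPowGood_sAbs hx₁.1 hx₁.2 (fun p => (hx₂ p).1) fun p => (hx₂ p).2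
    | some none => exists_isPowGood_gradNorm_infinite hd₀ hx₁.1 hx₁.2
    | some (some p) => exists_isPowGood_gradNorm_finite p (hd p) (hx₂ p).1 (hx₂ p).2
  have hG0 : ∀ i γ x, 0 ≤ G i γ x := by
    rintro (_ | _ | p) γ x
    · exact sAbs_nonneg _
    · exact norm_nonneg _
    · exact norm_nonneg _
  have hGc : ∀ i γ, ContinuousOn (G i γ) (sProd U₀ U) := by
    have c₁ : ∀ {Z : Type} [TopologicalSpace Z] {g : (Fin d₀ → ℝ) → Z} {x : SSpace S d₀ d},
        ContinuousAt g x.1.ofLp → ContinuousAt (fun x : SSpace S d₀ d => g x.1.ofLp) x :=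
      fun hg => hg.comp (f := fun x : SSpace S d₀ d => x.1.ofLp)
        ((PiLp.continuous_ofLp 2 _).comp continuous_fst).continuousAt
    have c₂ : ∀ {Z : Type} [TopologicalSpace Z] (p : S)
        {g : (Fin (d p) → ℚ_[(p : Nat.Primes)]) → Z} {x : SSpace S d₀ d},
        ContinuousAt g (x.2 p) → ContinuousAt (fun x : SSpace S d₀ d => g (x.2 p)) x :=
      fun p g x hg => hg.comp (f := fun x : SSpace S d₀ d => x.2 p)
        ((continuous_apply p).comp continuous_snd).continuousAt
    rintro i γ x hx
    refine ContinuousAt.continuousWithinAt ?_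
    have a₁ := dotAdd_analyticAt (han₀ _ hx.1).1 (han₀ _ hx.1).2 γ.2
    have a₂ := fun p => dotAdd_analyticAt (han p _ (hx.2 p)).1 (han p _ (hx.2 p)).2 γ.2
    rcases i with _ | _ | p
    · refine continuous_sAbs.continuousAt.comp (continuousAt_const.add ?_)
      exact (c₁ a₁.continuousAt).prodMk (continuousAt_pi.2 fun p => c₂ p (a₂ p).continuousAt)
    · exact c₁ (continuousAt_gradNorm 2 a₁)
    · exact c₂ p (continuousAt_gradNorm ∞ (a₂ p))
  obtain ⟨L, C, R, hL, hC, hR, H⟩ := IsPowGood.exists_uniform hfin hG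
  obtain ⟨R₁, hR₁, hsub⟩ := Metric.isOpen_iff.1 hopen x₀ hx₀
  -- A ball inside the ball of radius `ρ` may have radius up to `2 * ρ`, which must not exceed `R`.
  set ρ := min (R / 2) R₁ with hρ
  have hρpos : 0 < ρ := by positivity
  have hVU : Metric.ball x₀ ρ ⊆ sProd U₀ U :=
    (Metric.ball_subset_ball (min_le_right _ _)).trans hsub
  set D := max d₀ (Finset.univ.sup d) with hD
  have hD1 : 1 ≤ D := hd₀.trans (le_max_left _ _)
  have hgood : ∀ i γ, IsGood (sMeasure S d₀ d) C (1 / ((D : ℝ) * (L : ℝ)))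
      (Metric.ball x₀ ρ) (G i γ) := by
    intro i γ
    rw [← Nat.cast_mul]
    -- The factor `D` in the exponent is a weakening of `1 / L`, so `k` and `k₁` can both be `L`.
    have h1 := (H i γ).mono hfin (L' := D * L) (Nat.le_mul_of_pos_left L hD1) le_rfl
      (by linarith) le_rfl
    refine h1.isGood hfin (hG0 i γ) (Nat.mul_pos hD1 hL) hC ?_ ?_ ?_
    · linarith [min_le_left (R / 2) R₁]
    · intro x r hr hxr
      linarith [le_two_mul_of_ball_subset_ball hd₀ hr hxr, min_le_left (R / 2) R₁]
    · exact (continuousOn_iff_continuous_domRestrict.1 ((hGc i γ).mono hVU)).measurable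
  refine ⟨Metric.ball x₀ ρ, Metric.isOpen_ball, Metric.mem_ball_self hρpos, hVU, C,
    by linarith, L, L, hL, hL, fun a₀ a => ⟨hgood none (a₀, a), hgood (some none) (a₀, a),
      fun p => hgood (some (some p)) (a₀, a)⟩⟩
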